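/- **Conventions.** A non-Archimedean Banach ring $K$ is a commutative unital ring, complete for a norm with $\|a\|=0\iff a=0$, $\|ab\|\le\|a\|\,\|b\|$ and $\|a+b\|\le\max(\|a\|,\|b\|)$. A Banach $K$-module is a $K$-module complete for an ultrametric norm with $\|av\|\le\|a\|\,\|v\|$. Torsion free as a $K$-module means that elements of $K$ that are not zero divisors act injectively. $\mathrm{End}(V)$ is the module of bounded $K$-linear operators on $V$ with the operator norm. A *field* on $V$ is a bounded family $a(z)=\sum_{n\in\mathbb Z}a_{(n)}z^{-n-1}$ in $\mathrm{End}(V)$ with $a_{(n)}v\to0$ as $n\to+\infty$ for all $v\in V$; its norm is $\|a(z)\|=\sup_n\|a_{(n)}\|$. The $n$-th product of fields is $a(w)_{(n)}b(w)=\mathrm{Res}_z\,(z-w)^n[a(z),b(w)]$ for $n\ge0$, and $a(z)_{(-m-1)}b(z)={:}(\tfrac1{m!}\partial_z^m a(z))\,b(z){:}$ for $m\ge0$, where ${:}a(z)b(z){:}=a(z)_+b(z)+b(z)a(z)_-$ with $a(z)_+=\sum_{n<0}a_{(n)}z^{-n-1}$ and $a(z)_-=\sum_{n\ge0}a_{(n)}z^{-n-1}$.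 A *vertex $K$-algebra* ($K$ torsion free as an abelian group) is a Banach $K$-module $V$, torsion free as a $K$-module and as an abelian group, with a vector $|0\rangle\in V$, a bounded operator $T\in\mathrm{End}(V)$ with $T|0\rangle=0$, and a closed $K$-submodule $\mathrm{Fld}(V)$ of the space of fields that contains the identity operator $I_V$ and is stable under all $n$-th products, such that for all $a(z),b(z)\in\mathrm{Fld}(V)$: $a(z)|0\rangle\in V[[z]]$; $[T,a(z)]=\partial_z a(z)$; $(z-w)^N[a(z),b(w)]\to0$ as $N\to\infty$ in the supremum norm; and such that, for the field-state homomorphism $fs:\mathrm{Fld}(V)\to V$, $a(z)\mapsto a_{(-1)}|0\rangle$, the set $\{v\in V:\lambda v\in \mathrm{Im}(fs)\text{ for some nonzero }\lambda\in K\}$ is dense in $V$. It is *admissible* if the norm on $\mathrm{Im}(fs)$ induced from $V$ is equivalent to the one transported from the quotient norm on $\mathrm{Fld}(V)/\mathrm{Ker}(fs)$. **Statement.** Let $R$ be a commutative ring with the trivial norm, and let $V$ be an ordinary vertex algebra over $R$, i.e. a vertex $R$-algebra in the above sense with the trivial norm on $V$. Assume that $V$ is a free $R$-module. Let $K$ be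 a commutative non-Archimedean Banach ring, torsion free as an abelian group, and let $R\to K$ be an injective ring homomorphism with $\|r\|_K\le1$ for all $r\in R$. Let $V_K=V\widehat\otimes_RK$ be the completed tensor product, with vacuum $|0\rangle\otimes1$, with translation operator the extension of $T$, and with $\mathrm{Fld}(V_K)$ the closed $K$-submodule generated by the extensions to $V_K$ of the fields in $\mathrm{Fld}(V)$, i.e. the closure of the smallest $K$-submodule of the space of fields on $V_K$ that contains these extensions and the identity operator and is stable under all $n$-th products. 1. If $fs:\mathrm{Fld}(V)\to V$ is bijective, then $fs:\mathrm{Fld}(V_K)\to V_K$ is an isometric isomorphism. 2. If the norm of $K$ induces the trivial norm on $R$, and if $\|r\lambda\|=\|r\|\,\|\lambda\|$ for all $r\in R$ and $\lambda\in K$ (for example, if the norm of $K$ is multiplicative, or if $R$ is a field), then $fs:\mathrm{Fld}(V_K)\to V_K$ is an isometric injection. In both cases $V_K$ is an admissible vertex $K$-algebra. -/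

import Mathlib

open Filter Topology
open scoped TensorProduct ENNReal

noncomputable section

namespace NAVertex

/-! ### Bounded operators, formal distributions and fields

A Banach module over a non-Archimedean commutative Banach ring `K` is a complete ultrametric
normed group `V` with `Module K V` and `IsBoundedSMul K V`, i.e. `‖c • v‖ ≤ ‖c‖ * ‖v‖`. -/

section Fields

variable (K V : Type*) [NormedCommRing K] [NormedAddCommGroup V] [Module K V] [IsBoundedSMul K V]

/-- `End(V)`: the bounded `K`-linear operators on `V`.  The norm (inherited from
`NormedAddGroupHom`) is the infimum of all `C ≥ 0` with `‖f v‖ ≤ C * ‖v‖` for all `v`. -/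
def BEnd : Submodule K (NormedAddGroupHom V V) where
  carrier := {f | ∀ (c : K) (v : V), f (c • v) = c • f v}
  add_mem' := by
    intro f g hf hg c v
    simp [hf c v, hg c v, smul_add]
  zero_mem' := by
    intro c v
    simp
  smul_mem' := by
    intro a f hf c v
    simp [hf c v, smul_comm a c]

variable {K V}

theorem BEnd.map_smul (f : BEnd K V) (c : K) (v : V) : f.1 (c • v) = c • f.1 v := f.2 c v

instance instIsBoundedSMulBEnd : IsBoundedSMul K (BEnd K V) :=
  IsBoundedSMul.of_norm_smul_le fun c f => by
    refine NormedAddGroupHom.opNorm_le_bound _ (by positivity) fun v => ?_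
    calc ‖c • f.1 v‖ ≤ ‖c‖ * ‖f.1 v‖ := norm_smul_le _ _
      _ ≤ ‖c‖ * (‖f.1‖ * ‖v‖) :=
        mul_le_mul_of_nonneg_left (f.1.le_opNorm v) (norm_nonneg c)
      _ = ‖c‖ * ‖f‖ * ‖v‖ := by rw [mul_assoc]; rfl

variable (K V)

/-- The identity operator `I_V`. -/
def BEnd.one : BEnd K V := ⟨NormedAddGroupHom.id V, fun _ _ => rfl⟩

/-- `End(V)[[z^{±1}]]`: bounded families `(a n)`, `n ∈ ℤ`, of elements of `End(V)`, with the
supremum norm.  The element `a` stands for `a(z) = ∑ n, a n * z ^ (-n - 1)`, i.e. `a n` is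
`a_{(n)}`. -/
abbrev Distribution : Type _ := lp (fun _ : ℤ => BEnd K V) ∞

variable {K V}

/-- The operator `a_{(n)}` of a formal distribution. -/
def Distribution.coeff (a : Distribution K V) (n : ℤ) : NormedAddGroupHom V V :=
  ((a : ∀ _ : ℤ, BEnd K V) n).1

variable (K V)

/-- The space of `End(V)`-valued fields: formal distributions `a(z)` such that
`a_{(n)} v → 0` as `n → +∞` for every `v`. -/
def fieldSpace : Submodule K (Distribution K V) where
  carrier := {a | ∀ v : V, Tendsto (fun n : ℤ => a.coeff n v) atTop (𝓝 0)}
  add_mem' := by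
    intro a b ha hb v
    have h := (ha v).add (hb v)
    rw [add_zero] at h
    exact h
  zero_mem' := by
    intro v
    exact tendsto_const_nhds
  smul_mem' := by
    intro c a ha v
    have h := (ha v).const_smul c
    rw [smul_zero] at h
    exact h

/-- The identity operator as a formal distribution: `I_V` is the coefficient of `z ^ 0`. -/
def idField : Distribution K V :=
  ⟨fun n => if n = -1 then BEnd.one K V else 0,
    memℓp_infty ⟨‖BEnd.one K V‖, by
      rintro _ ⟨n, rfl⟩
      dsimp only
      split_ifs
      · exact le_rfl
      · simp⟩⟩

variable {K V}

/-- The commutator of two operators. -/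
def comm (f g : NormedAddGroupHom V V) : NormedAddGroupHom V V := f.comp g - g.comp f

/-- The coefficient at `z ^ (-m - 1) * w ^ (-n - 1)` of `(z - w) ^ N * [a(z), b(w)]`. -/
def localityCoeff (a b : Distribution K V) (N : ℕ) (m n : ℤ) : NormedAddGroupHom V V :=
  ∑ j ∈ Finset.range (N + 1),
    ((-1 : ℤ) ^ j * (N.choose j : ℤ)) • comm (a.coeff (m + (N : ℤ) - (j : ℤ))) (b.coeff (n + (j : ℤ)))

/-- `a(z)` and `b(z)` are mutually local: `(z - w) ^ N * [a(z), b(w)] → 0` as `N → ∞` for the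
supremum norm on `End(V)[[z^{±1}, w^{±1}]]`. -/
def MutuallyLocal (a b : Distribution K V) : Prop :=
  ∀ ε : ℝ, 0 < ε → ∃ N₀ : ℕ, ∀ N : ℕ, N₀ ≤ N → ∀ m n : ℤ, ‖localityCoeff a b N m n‖ ≤ ε

/-- `[T, a(z)] = ∂_z a(z)`, i.e. `[T, a_{(n)}] = -n a_{(n-1)}` for all `n`. -/
def TranslationCovariant (T : BEnd K V) (a : Distribution K V) : Prop :=
  ∀ n : ℤ, comm T.1 (a.coeff n) = (-n) • a.coeff (n - 1)

/-- The coefficients `(∂_z^{(m)} a(z))_{(k)}`, where `∂_z^{(m)} = ∂_z^m / m!`, that is,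
`∂_z^{(m)} z ^ l = binom(l, m) z ^ (l - m)`. -/
def hasseCoeff (m : ℕ) (a : Distribution K V) (k : ℤ) : NormedAddGroupHom V V :=
  (Ring.choose (-(k - (m : ℤ)) - 1) m : ℤ) • a.coeff (k - (m : ℤ))

/-- `c(z)` is the `n`-th product `a(z)_{(n)} b(z)`.
For `n ≥ 0` it is `Res_z ((z - w) ^ n [a(z), b(w)])`.
For `n = -m - 1 < 0` it is the normally ordered product `:a'(z) b(z):`
`= a'(z)_+ b(z) + b(z) a'(z)_-` of `a'(z) = ∂_z^{(m)} a(z)` and `b(z)`, whose coefficients are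
pointwise convergent sums; here `a'(z)_+` collects the terms `a'_{(k)} z ^ (-k - 1)` with
`k ≤ -1` and `a'(z)_-` those with `k ≥ 0`. -/
def IsNthProduct (a b : Distribution K V) : ℤ → Distribution K V → Prop
  | Int.ofNat n, c => ∀ p : ℤ, c.coeff p =
      ∑ i ∈ Finset.range (n + 1), ((-1 : ℤ) ^ (n - i) * (n.choose i : ℤ)) •
        comm (a.coeff (i : ℤ)) (b.coeff (p + (n : ℤ) - (i : ℤ)))
  | Int.negSucc m, c => ∀ (p : ℤ) (v : V), HasSum
      (fun k : ℤ => if k < 0 then hasseCoeff m a k (b.coeff (p - 1 - k) v)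
        else b.coeff (p - 1 - k) (hasseCoeff m a k v)) (c.coeff p v)

/-- The `K`-submodule of the space of fields generated by a family `F`: the smallest one that
contains `F` and `I_V` and is preserved by all `n`-th products. -/
def generatedFields (F : Set (Distribution K V)) : Submodule K (Distribution K V) :=
  sInf {S | S ≤ fieldSpace K V ∧ F ⊆ S ∧ idField K V ∈ S ∧
    ∀ a ∈ S, ∀ b ∈ S, ∀ (n : ℤ) (c : Distribution K V), IsNthProduct a b n c → c ∈ S}

/-- The closed `K`-submodule generated by a family `F` of fields. -/
def closedGeneratedFields (F : Set (Distribution K V)) : Submodule K (Distribution K V) :=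
  (generatedFields F).topologicalClosure

end Fields

/-! ### Vertex algebras -/

/-- A homomorphism `φ` of Banach modules is admissible if it is bounded and the norm on its image
is equivalent to the one transported from the quotient norm on `U / ker φ`. -/
def IsAdmissibleHom {K U W : Type*} [NormedCommRing K] [NormedAddCommGroup U] [Module K U]
    [NormedAddCommGroup W] [Module K W] (φ : U →ₗ[K] W) : Prop :=
  (∃ C : ℝ, ∀ u : U, ‖φ u‖ ≤ C * ‖u‖) ∧
  ∃ c C : ℝ, 0 < c ∧ 0 < C ∧ ∀ u : U,
    c * ‖(Submodule.Quotient.mk u : U ⧸ LinearMap.ker φ)‖ ≤ ‖φ u‖ ∧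
      ‖φ u‖ ≤ C * ‖(Submodule.Quotient.mk u : U ⧸ LinearMap.ker φ)‖

/-- The data of a vertex `K`-algebra on `V`: vacuum vector, translation operator and space of
fields.  The axioms are in `VertexData.IsVertexAlgebra`. -/
structure VertexData (K V : Type*) [NormedCommRing K] [NormedAddCommGroup V] [Module K V]
    [IsBoundedSMul K V] where
  vacuum : V
  T : BEnd K V
  Fld : Submodule K (Distribution K V)

namespace VertexData

variable {K V : Type*} [NormedCommRing K] [NormedAddCommGroup V] [Module K V] [IsBoundedSMul K V]

/-- The field-state homomorphism `fs : Fld(V) → V`, `a(z) ↦ a_{(-1)} |0⟩`. -/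
def fs (D : VertexData K V) : D.Fld →ₗ[K] V where
  toFun a := a.1.coeff (-1) D.vacuum
  map_add' _ _ := rfl
  map_smul' _ _ := rfl

/-- The axioms of a (non-Archimedean) vertex `K`-algebra. -/
structure IsVertexAlgebra (D : VertexData K V) : Prop where
  ring_complete : CompleteSpace K
  ring_ultrametric : IsUltrametricDist K
  ring_torsionFree : IsAddTorsionFree K
  complete : CompleteSpace V
  ultrametric : IsUltrametricDist V
  addTorsionFree : IsAddTorsionFree V
  torsionFree : Module.IsTorsionFree K V
  T_vacuum : D.T.1 D.vacuum = 0
  fld_le : D.Fld ≤ fieldSpace K V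
  fld_closed : IsClosed (D.Fld : Set (Distribution K V))
  id_mem : idField K V ∈ D.Fld
  /-- `a(z)|0⟩ ∈ V[[z]]` -/
  vacuum_axiom : ∀ a ∈ D.Fld, ∀ n : ℤ, 0 ≤ n → a.coeff n D.vacuum = 0
  translation : ∀ a ∈ D.Fld, TranslationCovariant D.T a
  locality : ∀ a ∈ D.Fld, ∀ b ∈ D.Fld, MutuallyLocal a b
  nthProduct : ∀ a ∈ D.Fld, ∀ b ∈ D.Fld, ∀ n : ℤ, ∃ c ∈ D.Fld, IsNthProduct a b n c
  /-- the `K`-saturation of the image of `fs` is dense -/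
  dense : Dense {v : V | ∃ c : K, c ≠ 0 ∧ c • v ∈ LinearMap.range D.fs}

/-- A vertex algebra is admissible if its field-state homomorphism is. -/
def IsAdmissible (D : VertexData K V) : Prop := IsAdmissibleHom D.fs

end VertexData

/-! ### Completed tensor products and extension of scalars -/

section BaseChange

variable (R K V : Type*) [NormedCommRing R] [NormedCommRing K] [Algebra R K]
  [NormedAddCommGroup V] [Module R V]

/-- The algebraic tensor product `K ⊗[R] V`, which is to carry the tensor seminorm. -/
def PreTensor : Type _ := K ⊗[R] V

instance : AddCommGroup (PreTensor R K V) := inferInstanceAs (AddCommGroup (K ⊗[R] V))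

instance : Module K (PreTensor R K V) := inferInstanceAs (Module K (K ⊗[R] V))

variable {R K V}

/-- The elementary tensor `x ⊗ v`. -/
def PreTensor.mk (x : K) (v : V) : PreTensor R K V := (x ⊗ₜ[R] v : K ⊗[R] V)

/-- `c` is an upper bound of `‖xᵢ‖ * ‖vᵢ‖` for some presentation of `t` as a finite sum of
elementary tensors `xᵢ ⊗ vᵢ`. -/
def PreTensor.IsBound (t : PreTensor R K V) (c : ℝ) : Prop :=
  0 ≤ c ∧ ∃ l : List (K × V), (l.map fun p => PreTensor.mk (R := R) p.1 p.2).sum = t ∧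
    ∀ p ∈ l, ‖p.1‖ * ‖p.2‖ ≤ c

/-- The tensor seminorm: the infimum, over all presentations `t = ∑ xᵢ ⊗ vᵢ`, of
`max ‖xᵢ‖ * ‖vᵢ‖`. -/
def PreTensor.seminorm (t : PreTensor R K V) : ℝ := sInf {c | t.IsBound c}

namespace PreTensor

theorem exists_isBound (t : PreTensor R K V) : ∃ c, t.IsBound c := by
  have key : ∀ t : K ⊗[R] V, ∃ c, PreTensor.IsBound (R := R) (K := K) (V := V) t c := by
    intro t
    induction t using TensorProduct.induction_on with
    | zero => exact ⟨0, le_rfl, [], rfl, by simp⟩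
    | tmul x v =>
      refine ⟨‖x‖ * ‖v‖, by positivity, [(x, v)], ?_, by simp⟩
      rw [List.map_singleton, List.sum_singleton]; rfl
    | add s t hs ht =>
      obtain ⟨c, hc, l, hl, hlc⟩ := hs
      obtain ⟨d, _, l', hl', hld⟩ := ht
      refine ⟨max c d, le_max_of_le_left hc, l ++ l', ?_, ?_⟩
      · rw [List.map_append, List.sum_append, hl, hl']; rfl
      · intro p hp
        rcases List.mem_append.1 hp with h | h
        · exact (hlc p h).trans (le_max_left _ _)
        · exact (hld p h).trans (le_max_right _ _)
  exact key t

theorem bddBelow (t : PreTensor R K V) : BddBelow {c | t.IsBound c} := ⟨0, fun _ h => h.1⟩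

theorem seminorm_nonneg (t : PreTensor R K V) : 0 ≤ t.seminorm := Real.sInf_nonneg fun _ h => h.1

theorem seminorm_le {t : PreTensor R K V} {c : ℝ} (h : t.IsBound c) : t.seminorm ≤ c :=
  csInf_le t.bddBelow h

theorem exists_lt (t : PreTensor R K V) {ε : ℝ} (hε : 0 < ε) :
    ∃ c, t.IsBound c ∧ c < t.seminorm + ε :=
  Real.lt_sInf_add_pos t.exists_isBound hε

theorem IsBound.add {s t : PreTensor R K V} {c d : ℝ} (hs : s.IsBound c) (ht : t.IsBound d) :
    (s + t).IsBound (max c d) := by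
  obtain ⟨hc, l, hl, hlc⟩ := hs
  obtain ⟨_, l', hl', hld⟩ := ht
  refine ⟨le_max_of_le_left hc, l ++ l', ?_, ?_⟩
  · rw [List.map_append, List.sum_append, hl, hl']
  · intro p hp
    rcases List.mem_append.1 hp with h | h
    · exact (hlc p h).trans (le_max_left _ _)
    · exact (hld p h).trans (le_max_right _ _)

theorem seminorm_add_le_max (s t : PreTensor R K V) :
    (s + t).seminorm ≤ max s.seminorm t.seminorm := by
  refine le_of_forall_pos_le_add fun ε hε => ?_
  obtain ⟨c, hc, hc'⟩ := s.exists_lt hε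
  obtain ⟨d, hd, hd'⟩ := t.exists_lt hε
  refine (seminorm_le (hc.add hd)).trans (max_le ?_ ?_)
  · exact hc'.le.trans (by gcongr; exact le_max_left _ _)
  · exact hd'.le.trans (by gcongr; exact le_max_right _ _)

/-- A map that is additive and acts on elementary tensors through maps of the factors multiplies
bounds by the product of the bounds of these maps. -/
theorem IsBound.map (F : PreTensor R K V →+ PreTensor R K V) (f : K → K) (g : V → V) {A B : ℝ}
    (hA : 0 ≤ A) (hB : 0 ≤ B) (hf : ∀ x, ‖f x‖ ≤ A * ‖x‖) (hg : ∀ v, ‖g v‖ ≤ B * ‖v‖)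
    (hF : ∀ x v, F (PreTensor.mk x v) = PreTensor.mk (f x) (g v))
    {t : PreTensor R K V} {c : ℝ} (ht : t.IsBound c) : (F t).IsBound (A * B * c) := by
  obtain ⟨hc, l, hl, hlc⟩ := ht
  refine ⟨by positivity, l.map fun p => (f p.1, g p.2), ?_, ?_⟩
  · rw [← hl, map_list_sum, List.map_map, List.map_map]
    congr 1
    refine List.map_congr_left fun p _ => ?_
    simp [hF]
  · intro p hp
    obtain ⟨q, hq, rfl⟩ := List.mem_map.1 hp
    calc ‖f q.1‖ * ‖g q.2‖ ≤ (A * ‖q.1‖) * (B * ‖q.2‖) :=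
          mul_le_mul (hf _) (hg _) (norm_nonneg _) (by positivity)
      _ = A * B * (‖q.1‖ * ‖q.2‖) := by ring
      _ ≤ A * B * c := mul_le_mul_of_nonneg_left (hlc q hq) (by positivity)

theorem seminorm_map_le (F : PreTensor R K V →+ PreTensor R K V) (f : K → K) (g : V → V) {A B : ℝ}
    (hA : 0 ≤ A) (hB : 0 ≤ B) (hf : ∀ x, ‖f x‖ ≤ A * ‖x‖) (hg : ∀ v, ‖g v‖ ≤ B * ‖v‖)
    (hF : ∀ x v, F (PreTensor.mk x v) = PreTensor.mk (f x) (g v)) (t : PreTensor R K V) :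
    (F t).seminorm ≤ A * B * t.seminorm := by
  have h : ∀ ε : ℝ, 0 < ε → (F t).seminorm ≤ A * B * (t.seminorm + ε) := by
    intro ε hε
    obtain ⟨c, hc, hc'⟩ := t.exists_lt hε
    exact (seminorm_le (hc.map F f g hA hB hf hg hF)).trans
      (mul_le_mul_of_nonneg_left hc'.le (by positivity))
  have hlim : Tendsto (fun ε : ℝ => A * B * (t.seminorm + ε)) (𝓝[>] 0) (𝓝 (A * B * t.seminorm)) := by
    have : Tendsto (fun ε : ℝ => A * B * (t.seminorm + ε)) (𝓝 0) (𝓝 (A * B * (t.seminorm + 0))) :=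
      Continuous.tendsto (by fun_prop) 0
    rw [add_zero] at this
    exact this.mono_left nhdsWithin_le_nhds
  exact ge_of_tendsto hlim (eventually_nhdsWithin_of_forall fun ε hε => h ε hε)

theorem seminorm_zero : (0 : PreTensor R K V).seminorm = 0 :=
  le_antisymm (seminorm_le ⟨le_rfl, [], rfl, by simp⟩) (seminorm_nonneg _)

theorem seminorm_neg (t : PreTensor R K V) : (-t).seminorm = t.seminorm := by
  have h : ∀ t : PreTensor R K V, (-t).seminorm ≤ t.seminorm := by
    intro t
    have := seminorm_map_le (-AddMonoidHom.id (PreTensor R K V)) (fun x => x) (fun v => -v)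
      zero_le_one zero_le_one (by simp) (by simp)
      (fun x v => (TensorProduct.tmul_neg x v).symm) t
    simpa using this
  exact le_antisymm (h t) (by simpa using h (-t))

end PreTensor

variable (R K V)

/-- The tensor seminorm as an `AddGroupSeminorm`. -/
def PreTensor.addGroupSeminorm : AddGroupSeminorm (PreTensor R K V) where
  toFun := PreTensor.seminorm
  map_zero' := PreTensor.seminorm_zero
  add_le' s t := (PreTensor.seminorm_add_le_max s t).trans
    (max_le_add_of_nonneg s.seminorm_nonneg t.seminorm_nonneg)
  neg' := PreTensor.seminorm_neg

instance : SeminormedAddCommGroup (PreTensor R K V) :=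
  (PreTensor.addGroupSeminorm R K V).toSeminormedAddCommGroup

theorem PreTensor.norm_def (t : PreTensor R K V) : ‖t‖ = t.seminorm := rfl

instance : IsBoundedSMul K (PreTensor R K V) :=
  IsBoundedSMul.of_norm_smul_le fun c t => by
    have := PreTensor.seminorm_map_le (DistribSMul.toAddMonoidHom (PreTensor R K V) c)
      (fun x => c * x) (fun v => v) (norm_nonneg c) zero_le_one (fun x => norm_mul_le c x) (by simp)
      (fun x v => TensorProduct.smul_tmul' c x v) t
    rw [mul_one] at this
    exact this

/-- The completed tensor product `V_K = K ⊗̂_R V`: the (separated) completion of `K ⊗[R] V` for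
the tensor seminorm, a Banach `K`-module. -/
abbrev ExtScalars : Type _ := UniformSpace.Completion (PreTensor R K V)

instance : IsBoundedSMul K (ExtScalars R K V) :=
  IsBoundedSMul.of_norm_smul_le fun c x => by
    induction x using UniformSpace.Completion.induction_on with
    | hp =>
      exact isClosed_le (continuous_norm.comp (continuous_const_smul c))
        (continuous_const.mul continuous_norm)
    | ih t =>
      rw [← UniformSpace.Completion.coe_smul, UniformSpace.Completion.norm_coe,
        UniformSpace.Completion.norm_coe]
      exact norm_smul_le c t

variable {R V} [IsBoundedSMul R V]

/-- The operator `1 ⊗ f` on the algebraic tensor product. -/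
def preExtend (f : BEnd R V) : NormedAddGroupHom (PreTensor R K V) (PreTensor R K V) :=
  AddMonoidHom.mkNormedAddGroupHom
    ((LinearMap.baseChange K
      ({ toFun := f.1, map_add' := map_add f.1, map_smul' := f.2 } : V →ₗ[R] V)).toAddMonoidHom :
        PreTensor R K V →+ PreTensor R K V)
    ‖f‖ fun t => by
      have := PreTensor.seminorm_map_le
        ((LinearMap.baseChange K
          ({ toFun := f.1, map_add' := map_add f.1, map_smul' := f.2 } :
            V →ₗ[R] V)).toAddMonoidHom : PreTensor R K V →+ PreTensor R K V)
        (fun x => x) f.1 zero_le_one (norm_nonneg f) (by simp) f.1.le_opNorm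
        (fun x v => rfl) t
      rw [one_mul] at this
      exact this

theorem preExtend_mk (f : BEnd R V) (x : K) (v : V) :
    preExtend K f (PreTensor.mk x v) = PreTensor.mk x (f.1 v) := rfl

theorem preExtend_smul (f : BEnd R V) (c : K) (t : PreTensor R K V) :
    preExtend K f (c • t) = c • preExtend K f t :=
  (LinearMap.baseChange K
    ({ toFun := f.1, map_add' := map_add f.1, map_smul' := f.2 } : V →ₗ[R] V)).map_smul c t

theorem norm_preExtend_le (f : BEnd R V) : ‖preExtend K f‖ ≤ ‖f‖ :=
  AddMonoidHom.mkNormedAddGroupHom_norm_le _ (norm_nonneg f) _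

/-- The extension of `f ∈ End(V)` to `V_K`: the continuous extension of `1 ⊗ f`. -/
def extendEnd (f : BEnd R V) : BEnd K (ExtScalars R K V) :=
  ⟨(preExtend K f).completion, by
    intro c x
    induction x using UniformSpace.Completion.induction_on with
    | hp =>
      exact isClosed_eq ((preExtend K f).completion.continuous.comp (continuous_const_smul c))
        ((preExtend K f).completion.continuous.const_smul c)
    | ih t =>
      rw [← UniformSpace.Completion.coe_smul, NormedAddGroupHom.completion_coe,
        NormedAddGroupHom.completion_coe, preExtend_smul, UniformSpace.Completion.coe_smul]⟩

theorem extendEnd_coe (f : BEnd R V) (x : K) (v : V) :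
    (extendEnd K f).1 ((PreTensor.mk x v : PreTensor R K V) : ExtScalars R K V) =
      ((PreTensor.mk x (f.1 v) : PreTensor R K V) : ExtScalars R K V) :=
  NormedAddGroupHom.completion_coe _ _

theorem norm_extendEnd_le (f : BEnd R V) : ‖extendEnd K f‖ ≤ ‖f‖ :=
  (NormedAddGroupHom.norm_completion (preExtend K f)).le.trans (norm_preExtend_le K f)

/-- The extension of a formal distribution to `V_K`, coefficient by coefficient. -/
def extendDistribution (a : Distribution R V) : Distribution K (ExtScalars R K V) :=
  ⟨fun n => extendEnd K ((a : ∀ _ : ℤ, BEnd R V) n), memℓp_infty ⟨‖a‖, by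
    rintro _ ⟨n, rfl⟩
    exact (norm_extendEnd_le K _).trans (lp.norm_apply_le_norm ENNReal.top_ne_zero a n)⟩⟩

/-- The vertex algebra `V_K = K ⊗̂_R V`: the vacuum is `1 ⊗ |0⟩`, the translation operator is the
extension of `T`, and the space of fields is the closed `K`-submodule generated by the extensions
of the fields of `V`.  (This is the tensor product of `V` with the vertex `K`-algebra `K`, whose
translation operator is zero and whose fields are the multiplications by elements of `K`.) -/
def VertexData.extendScalars (D : VertexData R V) : VertexData K (ExtScalars R K V) where
  vacuum := ((PreTensor.mk 1 D.vacuum : PreTensor R K V) : ExtScalars R K V)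
  T := extendEnd K D.T
  Fld := closedGeneratedFields (extendDistribution K '' (D.Fld : Set (Distribution R V)))

end BaseChange

end NAVertex

end

noncomputable section

namespace NAVertex

/-! ### Coefficients of distributions, closedness and completeness -/

section Basic

variable {K V : Type*} [NormedCommRing K] [NormedAddCommGroup V] [Module K V] [IsBoundedSMul K V]

/-! Over an ultrametric module, integers act with norm at most 1, so binomial coefficients cost
nothing: the coefficients of `(z - w) ^ N * [a(z), b(w)]` and the `n`-th products are biadditive,
`K`-homogeneous in each factor and bounded by `‖a‖ * ‖b‖`, uniformly in all indices. Every axiom on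
fields therefore passes from a set of fields to the closure of its `K`-span. Since extension to
`V_K` commutes with `n`-th products, `Fld(V_K)` is simply the closed span of the extended fields
(`extendScalars_fld_eq`), and the axioms are inherited from `V`.

Freeness of `V` enters through coordinates. A basis of `V` gives coordinate maps `V_K → K`, and the
norm of `V_K` is the supremum norm of the coordinates (`norm_coord_le`, `norm_le_of_coord_le`).
Torsion-freeness, and the fact that a scalar which does not decrease norms in `K` does not decrease
them in `V_K`, can then be checked coordinatewise.

The heart is the inequality `‖a‖ ≤ ‖fs a‖`. For `a` in the span of the extended fields only finitely
many basis vectors `B i` matter. Choose `r : R` that does not decrease norms in `K`, with each such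
`r • B i` equal to `fs (c i)` for a field `c i` of `V`. Injectivity of `fs` on `V` then gives `r • a
= ∑ i, coord i (fs a) • c i`, the `c i` being extended to `V_K` (`smul_eq_sum_coord_smul`). Extended
fields have norm at most 1 because the norm of `V` is trivial, so `‖a‖ ≤ ‖r • a‖ ≤ ‖fs a‖`. The
inequality is a closed condition and so holds on all of `Fld(V_K)`; the reverse one holds because
the vacuum has norm at most 1.

In the first case `r = 1` works, and the image of `fs` is complete, hence closed, and contains all
elementary tensors. In the second case multiplicativity makes `R` a domain on whose nonzero elements
multiplication in `K` preserves norms; density gives `r` because `V` is discrete, and injectivity on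
`V` is Goddard's uniqueness argument (`coeff_fs_eq_zero`, `fs_injective`). -/

@[simp] theorem Distribution.coeff_add (a b : Distribution K V) (n : ℤ) :
    (a + b).coeff n = a.coeff n + b.coeff n := rfl

@[simp] theorem Distribution.coeff_sub (a b : Distribution K V) (n : ℤ) :
    (a - b).coeff n = a.coeff n - b.coeff n := rfl

@[simp] theorem Distribution.coeff_smul (c : K) (a : Distribution K V) (n : ℤ) :
    (c • a).coeff n = c • a.coeff n := rfl

@[simp] theorem Distribution.coeff_zero (n : ℤ) : (0 : Distribution K V).coeff n = 0 := rfl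

theorem Distribution.coeff_mem (a : Distribution K V) (n : ℤ) : a.coeff n ∈ BEnd K V :=
  ((a : ∀ _ : ℤ, BEnd K V) n).2

theorem Distribution.coeff_map_smul (a : Distribution K V) (n : ℤ) (c : K) (v : V) :
    a.coeff n (c • v) = c • a.coeff n v := a.coeff_mem n c v

theorem Distribution.ext_coeff {a b : Distribution K V} (h : ∀ n, a.coeff n = b.coeff n) :
    a = b :=
  lp.ext (funext fun n => Subtype.ext (h n))

theorem Distribution.norm_coeff_le (a : Distribution K V) (n : ℤ) : ‖a.coeff n‖ ≤ ‖a‖ :=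
  lp.norm_apply_le_norm ENNReal.top_ne_zero a n

theorem Distribution.norm_le {a : Distribution K V} {C : ℝ} (hC : 0 ≤ C)
    (h : ∀ n v, ‖a.coeff n v‖ ≤ C * ‖v‖) : ‖a‖ ≤ C :=
  lp.norm_le_of_forall_le hC fun n => NormedAddGroupHom.opNorm_le_bound _ hC (h n)

theorem Distribution.norm_coeff_apply_le (a : Distribution K V) (n : ℤ) (v : V) :
    ‖a.coeff n v‖ ≤ ‖a‖ * ‖v‖ :=
  NormedAddGroupHom.le_of_opNorm_le _ (a.norm_coeff_le n) v

/-- The formal distribution with prescribed uniformly bounded coefficients. -/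
def Distribution.ofCoeff (f : ℤ → NormedAddGroupHom V V) (hf : ∀ n, f n ∈ BEnd K V) (C : ℝ)
    (hC : ∀ n, ‖f n‖ ≤ C) : Distribution K V :=
  ⟨fun n => ⟨f n, hf n⟩, memℓp_infty ⟨C, by rintro _ ⟨n, rfl⟩; exact hC n⟩⟩

theorem continuous_coeff_apply (n : ℤ) (v : V) :
    Continuous fun a : Distribution K V => a.coeff n v := by
  refine LipschitzWith.continuous (K := ‖v‖₊) (LipschitzWith.of_dist_le_mul fun a b => ?_)
  rw [dist_eq_norm, dist_eq_norm, mul_comm]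
  exact (a - b).norm_coeff_apply_le n v

theorem comp_mem_bEnd {f g : NormedAddGroupHom V V} (hf : f ∈ BEnd K V) (hg : g ∈ BEnd K V) :
    f.comp g ∈ BEnd K V := by
  intro c v
  change f (g (c • v)) = c • f (g v)
  rw [show g (c • v) = c • g v from hg c v]
  exact hf c _

theorem comm_mem_bEnd {f g : NormedAddGroupHom V V} (hf : f ∈ BEnd K V) (hg : g ∈ BEnd K V) :
    comm f g ∈ BEnd K V :=
  sub_mem (comp_mem_bEnd hf hg) (comp_mem_bEnd hg hf)

theorem comm_apply (f g : NormedAddGroupHom V V) (v : V) : comm f g v = f (g v) - g (f v) := rfl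

/-- The estimate `‖(a - b).coeff n v‖ ≤ ‖a - b‖ * ‖v‖` is uniform in `n`, so convergence to zero
survives norm limits. -/
theorem isClosed_fieldSpace : IsClosed (fieldSpace K V : Set (Distribution K V)) := by
  refine isClosed_of_closure_subset fun a ha v => ?_
  rw [Metric.tendsto_nhds]
  intro ε hε
  obtain ⟨b, hb, hab⟩ := Metric.mem_closure_iff.1 ha (ε / 2 / (‖v‖ + 1)) (by positivity)
  filter_upwards [Metric.tendsto_nhds.1 (hb v) (ε / 2) (by positivity)] with n hn
  rw [dist_zero_right] at hn ⊢
  have h1 : ‖(a - b).coeff n v‖ ≤ ε / 2 := by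
    refine ((a - b).norm_coeff_apply_le n v).trans ?_
    rw [dist_eq_norm] at hab
    calc ‖a - b‖ * ‖v‖ ≤ ε / 2 / (‖v‖ + 1) * (‖v‖ + 1) := by gcongr; linarith
      _ = ε / 2 := by field_simp
  have h2 : a.coeff n v = (a - b).coeff n v + b.coeff n v := by simp
  rw [h2]
  exact (norm_add_le _ _).trans_lt (by linarith)

theorem isClosed_bEnd : IsClosed (BEnd K V : Set (NormedAddGroupHom V V)) := by
  refine isClosed_of_closure_subset fun f hf c v => ?_
  have hc : ∀ w : V, Continuous fun g : NormedAddGroupHom V V => g w := fun w =>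
    (LipschitzWith.of_dist_le_mul (K := ‖w‖₊) fun g h => by
      rw [dist_eq_norm, dist_eq_norm, mul_comm]; exact (g - h).le_opNorm w).continuous
  have : IsClosed {g : NormedAddGroupHom V V | g (c • v) = c • g v} :=
    isClosed_eq (hc _) ((hc v).const_smul c)
  exact closure_minimal (fun g (hg : g ∈ BEnd K V) => hg c v) this hf

theorem completeSpace_normedAddGroupHom {U W : Type*} [SeminormedAddCommGroup U]
    [NormedAddCommGroup W] [CompleteSpace W] : CompleteSpace (NormedAddGroupHom U W) := by
  refine Metric.complete_of_cauchySeq_tendsto fun u hu => ?_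
  have hpt : ∀ v, CauchySeq fun i => u i v := fun v =>
    (LipschitzWith.of_dist_le_mul (K := ‖v‖₊) fun g h => by
      rw [dist_eq_norm, dist_eq_norm, mul_comm]
      exact (g - h).le_opNorm v : LipschitzWith ‖v‖₊ fun g : NormedAddGroupHom U W => g v
      ).uniformContinuous.comp_cauchySeq hu
  choose f hf using fun v => cauchySeq_tendsto_of_complete (hpt v)
  obtain ⟨C, hC⟩ := (isBounded_iff_forall_norm_le.1 hu.isBounded_range)
  let F : NormedAddGroupHom U W := AddMonoidHom.mkNormedAddGroupHom
    (AddMonoidHom.mk' f fun v w => tendsto_nhds_unique (hf (v + w)) (by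
      simpa using (hf v).add (hf w))) C fun v =>
    le_of_tendsto (hf v).norm (Eventually.of_forall fun i =>
      (u i).le_of_opNorm_le (hC _ ⟨i, rfl⟩) v)
  refine ⟨F, Metric.tendsto_atTop.2 fun ε hε => ?_⟩
  obtain ⟨N, hN⟩ := Metric.cauchySeq_iff.1 hu (ε / 2) (half_pos hε)
  refine ⟨N, fun i hi => ?_⟩
  refine lt_of_le_of_lt ?_ (half_lt_self hε)
  rw [dist_eq_norm]
  refine NormedAddGroupHom.opNorm_le_bound _ (half_pos hε).le fun v => ?_
  have : Tendsto (fun j => ‖(u i - u j) v‖) atTop (𝓝 ‖(u i - F) v‖) :=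
    ((tendsto_const_nhds (x := u i v)).sub (hf v)).norm
  refine le_of_tendsto this ?_
  filter_upwards [eventually_ge_atTop N] with j hj
  refine NormedAddGroupHom.le_of_opNorm_le _ ?_ v
  rw [← dist_eq_norm]
  exact (hN i hi j hj).le

/-- Needed for surjectivity: a closed space of fields is then complete, and its image under an
isometry is closed. -/
theorem completeSpace_distribution [CompleteSpace V] : CompleteSpace (Distribution K V) := by
  have := completeSpace_normedAddGroupHom (U := V) (W := V)
  have : CompleteSpace (BEnd K V) := isClosed_bEnd.completeSpace_coe
  infer_instance

theorem localityCoeff_add_left (a a' b : Distribution K V) (N : ℕ) (m n : ℤ) :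
    localityCoeff (a + a') b N m n = localityCoeff a b N m n + localityCoeff a' b N m n := by
  rw [localityCoeff, localityCoeff, localityCoeff, ← Finset.sum_add_distrib]
  refine Finset.sum_congr rfl fun j _ => ?_
  rw [← smul_add]
  congr 1
  ext v
  simp [comm_apply]
  abel

theorem localityCoeff_add_right (a b b' : Distribution K V) (N : ℕ) (m n : ℤ) :
    localityCoeff a (b + b') N m n = localityCoeff a b N m n + localityCoeff a b' N m n := by
  rw [localityCoeff, localityCoeff, localityCoeff, ← Finset.sum_add_distrib]
  refine Finset.sum_congr rfl fun j _ => ?_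
  rw [← smul_add]
  congr 1
  ext v
  simp [comm_apply]
  abel

theorem localityCoeff_smul_left (c : K) (a b : Distribution K V) (N : ℕ) (m n : ℤ) :
    localityCoeff (c • a) b N m n = c • localityCoeff a b N m n := by
  rw [localityCoeff, localityCoeff, Finset.smul_sum]
  refine Finset.sum_congr rfl fun j _ => ?_
  rw [smul_comm c]
  congr 1
  ext v
  simp [comm_apply, smul_sub, Distribution.coeff_map_smul]

theorem localityCoeff_smul_right (c : K) (a b : Distribution K V) (N : ℕ) (m n : ℤ) :
    localityCoeff a (c • b) N m n = c • localityCoeff a b N m n := by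
  rw [localityCoeff, localityCoeff, Finset.smul_sum]
  refine Finset.sum_congr rfl fun j _ => ?_
  rw [smul_comm c]
  congr 1
  ext v
  simp [comm_apply, smul_sub, Distribution.coeff_map_smul]

end Basic

/-! ### Ultrametric norms on operators, and locality in closed spans -/

section Ultrametric

variable {K V : Type*} [NormedCommRing K] [NormedAddCommGroup V] [Module K V] [IsBoundedSMul K V]
  [IsUltrametricDist V]

instance : IsUltrametricDist (NormedAddGroupHom V V) :=
  IsUltrametricDist.isUltrametricDist_of_forall_norm_add_le_max_norm fun f g =>
    NormedAddGroupHom.opNorm_le_bound _ (le_max_of_le_left (norm_nonneg f)) fun v => by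
      refine (IsUltrametricDist.norm_add_le_max (f v) (g v)).trans (max_le ?_ ?_)
      · exact f.le_of_opNorm_le (le_max_left _ _) v
      · exact g.le_of_opNorm_le (le_max_right _ _) v

instance : IsUltrametricDist (Distribution K V) :=
  IsUltrametricDist.isUltrametricDist_of_forall_norm_add_le_max_norm fun a b =>
    lp.norm_le_of_forall_le (le_max_of_le_left (norm_nonneg a)) fun n =>
      (IsUltrametricDist.norm_add_le_max (a.coeff n) (b.coeff n)).trans
        (max_le_max (a.norm_coeff_le n) (b.norm_coeff_le n))

theorem norm_comm_le (f g : NormedAddGroupHom V V) : ‖comm f g‖ ≤ ‖f‖ * ‖g‖ := by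
  have h := IsUltrametricDist.norm_add_le_max (f.comp g) (-(g.comp f))
  rw [norm_neg, ← sub_eq_add_neg] at h
  refine h.trans (max_le (NormedAddGroupHom.norm_comp_le f g) ?_)
  rw [mul_comm]
  exact NormedAddGroupHom.norm_comp_le g f

theorem norm_comm_coeff_le (a b : Distribution K V) (m n : ℤ) :
    ‖comm (a.coeff m) (b.coeff n)‖ ≤ ‖a‖ * ‖b‖ :=
  (norm_comm_le _ _).trans
    (mul_le_mul (a.norm_coeff_le m) (b.norm_coeff_le n) (norm_nonneg _) (norm_nonneg _))

/-! ### Locality -/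

/-- The bound does not depend on `N`, since the binomial coefficients do not increase ultrametric
norms. This uniformity is what lets locality pass to limits. -/
theorem norm_localityCoeff_le (a b : Distribution K V) (N : ℕ) (m n : ℤ) :
    ‖localityCoeff a b N m n‖ ≤ ‖a‖ * ‖b‖ :=
  IsUltrametricDist.norm_sum_le_of_forall_le_of_nonneg (by positivity) fun _ _ =>
    (IsUltrametricDist.norm_zsmul_le _ _).trans (norm_comm_coeff_le a b _ _)

/-- A property of distributions that is a uniform smallness condition on a family of maps that are
additive, `K`-homogeneous and uniformly bounded defines a closed submodule. -/
def uniformlySmall (φ : ℕ → ℤ → ℤ → Distribution K V → NormedAddGroupHom V V) (C : ℝ)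
    (hadd : ∀ N m n a a', φ N m n (a + a') = φ N m n a + φ N m n a')
    (hsmul : ∀ N m n (c : K) a, φ N m n (c • a) = c • φ N m n a)
    (hφ : ∀ N m n a, ‖φ N m n a‖ ≤ C * ‖a‖) : Submodule K (Distribution K V) where
  carrier := {a | ∀ ε : ℝ, 0 < ε → ∃ N₀ : ℕ, ∀ N : ℕ, N₀ ≤ N → ∀ m n : ℤ, ‖φ N m n a‖ ≤ ε}
  add_mem' := by
    intro a a' ha ha' ε hε
    obtain ⟨N, hN⟩ := ha ε hε
    obtain ⟨N', hN'⟩ := ha' ε hε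
    refine ⟨max N N', fun M hM m n => ?_⟩
    rw [hadd]
    exact (IsUltrametricDist.norm_add_le_max _ _).trans
      (max_le (hN M (le_of_max_le_left hM) m n) (hN' M (le_of_max_le_right hM) m n))
  zero_mem' := by
    intro ε hε
    refine ⟨0, fun N _ m n => (hφ N m n 0).trans ?_⟩
    simpa using hε.le
  smul_mem' := by
    intro c a ha ε hε
    -- Adding 1 avoids division by zero when `c = 0`.
    obtain ⟨N, hN⟩ := ha (ε / (‖c‖ + 1)) (by positivity)
    refine ⟨N, fun M hM m n => ?_⟩
    rw [hsmul]
    refine (NormedAddGroupHom.opNorm_le_bound _ hε.le fun v => ?_)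
    calc ‖c • φ M m n a v‖ ≤ ‖c‖ * ‖φ M m n a v‖ := norm_smul_le _ _
      _ ≤ (‖c‖ + 1) * (ε / (‖c‖ + 1) * ‖v‖) := by
        gcongr
        · linarith
        · exact NormedAddGroupHom.le_of_opNorm_le _ (hN M hM m n) v
      _ = ε * ‖v‖ := by field_simp

theorem isClosed_uniformlySmall (φ : ℕ → ℤ → ℤ → Distribution K V → NormedAddGroupHom V V)
    (C : ℝ) (hadd : ∀ N m n a a', φ N m n (a + a') = φ N m n a + φ N m n a')
    (hsmul : ∀ N m n (c : K) a, φ N m n (c • a) = c • φ N m n a)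
    (hφ : ∀ N m n a, ‖φ N m n a‖ ≤ C * ‖a‖) (hC : 0 ≤ C) :
    IsClosed (uniformlySmall φ C hadd hsmul hφ : Set (Distribution K V)) := by
  refine isClosed_of_closure_subset fun a ha ε hε => ?_
  obtain ⟨b, hb, hab⟩ := Metric.mem_closure_iff.1 ha (ε / (C + 1)) (by positivity)
  obtain ⟨N, hN⟩ := hb ε hε
  refine ⟨N, fun M hM m n => ?_⟩
  have h : a = (a - b) + b := by simp
  rw [h, hadd]
  refine (IsUltrametricDist.norm_add_le_max _ _).trans (max_le ?_ (hN M hM m n))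
  rw [dist_eq_norm] at hab
  calc ‖φ M m n (a - b)‖ ≤ C * ‖a - b‖ := hφ _ _ _ _
    _ ≤ (C + 1) * (ε / (C + 1)) := by gcongr; linarith
    _ = ε := by field_simp

/-- One variable at a time: for a fixed partner, the distributions local to it form a closed
submodule by `uniformlySmall`. -/
theorem mutuallyLocal_of_mem_closure_span {S : Set (Distribution K V)}
    (hS : ∀ a ∈ S, ∀ b ∈ S, MutuallyLocal a b) {a b : Distribution K V}
    (ha : a ∈ (Submodule.span K S).topologicalClosure)
    (hb : b ∈ (Submodule.span K S).topologicalClosure) : MutuallyLocal a b := by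
  have h1 : ∀ b ∈ S, ∀ a ∈ (Submodule.span K S).topologicalClosure, MutuallyLocal a b := by
    intro b hb
    have := isClosed_uniformlySmall (K := K) (V := V) (fun N m n a => localityCoeff a b N m n) ‖b‖
      (fun N m n a a' => localityCoeff_add_left a a' b N m n)
      (fun N m n c a => localityCoeff_smul_left c a b N m n)
      (fun N m n a => (norm_localityCoeff_le a b N m n).trans_eq (mul_comm _ _)) (norm_nonneg _)
    exact Submodule.topologicalClosure_minimal _ (Submodule.span_le.2 fun a ha => hS a ha b hb) this
  have := isClosed_uniformlySmall (K := K) (V := V) (fun N m n b => localityCoeff a b N m n) ‖a‖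
    (fun N m n b b' => localityCoeff_add_right a b b' N m n)
    (fun N m n c b => localityCoeff_smul_right c a b N m n)
    (fun N m n b => norm_localityCoeff_le a b N m n) (norm_nonneg _)
  exact Submodule.topologicalClosure_minimal _
    (Submodule.span_le.2 fun b hb => h1 b hb a ha) this hb

end Ultrametric

/-! ### The `n`-th products as bounded bilinear operations -/

theorem norm_le_of_hasSum {ι E : Type*} [SeminormedAddCommGroup E] [IsUltrametricDist E]
    {f : ι → E} {s : E} {C : ℝ} (hC : 0 ≤ C) (hf : ∀ i, ‖f i‖ ≤ C) (hs : HasSum f s) : ‖s‖ ≤ C :=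
  le_of_tendsto hs.norm (Eventually.of_forall fun _ =>
    IsUltrametricDist.norm_sum_le_of_forall_le_of_nonneg hC fun i _ => hf i)

section Products

variable {K V : Type*} [NormedCommRing K] [NormedAddCommGroup V] [Module K V] [IsBoundedSMul K V]

/-- The terms of the series defining the coefficients of the `n`-th product; for `n ≥ 0` the
finite sum is concentrated in the term of index `0`. -/
def nthTerm (a b : Distribution K V) : ℤ → ℤ → ℤ → NormedAddGroupHom V V
  | Int.ofNat n, p, k => if k = 0 then
      ∑ i ∈ Finset.range (n + 1), ((-1 : ℤ) ^ (n - i) * (n.choose i : ℤ)) •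
        comm (a.coeff (i : ℤ)) (b.coeff (p + (n : ℤ) - (i : ℤ))) else 0
  | Int.negSucc m, p, k => if k < 0 then (hasseCoeff m a k).comp (b.coeff (p - 1 - k))
      else (b.coeff (p - 1 - k)).comp (hasseCoeff m a k)

/-- Puts the residue products and the normally ordered products in the common form of a pointwise
convergent series, so that linearity, bounds and existence are proved once for all `n`. -/
theorem isNthProduct_iff (a b c : Distribution K V) (n : ℤ) :
    IsNthProduct a b n c ↔
      ∀ p v, HasSum (fun k => nthTerm a b n p k v) (c.coeff p v) := by
  cases n with
  | ofNat n =>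
    have h : ∀ p v, HasSum (fun k => nthTerm a b (Int.ofNat n) p k v)
        ((∑ i ∈ Finset.range (n + 1), ((-1 : ℤ) ^ (n - i) * (n.choose i : ℤ)) •
          comm (a.coeff (i : ℤ)) (b.coeff (p + (n : ℤ) - (i : ℤ)))) v) := by
      intro p v
      convert hasSum_ite_eq (0 : ℤ) ((∑ i ∈ Finset.range (n + 1),
        ((-1 : ℤ) ^ (n - i) * (n.choose i : ℤ)) •
          comm (a.coeff (i : ℤ)) (b.coeff (p + (n : ℤ) - (i : ℤ)))) v) using 2 with k
      simp only [nthTerm]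
      split_ifs <;> rfl
    constructor
    · intro hc p v
      rw [hc p]
      exact h p v
    · intro hc p
      ext v
      exact (hc p v).unique (h p v)
  | negSucc m =>
    refine forall_congr' fun p => forall_congr' fun v => ?_
    refine iff_of_eq (congrArg (fun f => HasSum f (c.coeff p v)) (funext fun k => ?_))
    simp only [nthTerm]
    split_ifs <;> rfl

theorem hasseCoeff_add (m : ℕ) (a a' : Distribution K V) (k : ℤ) :
    hasseCoeff m (a + a') k = hasseCoeff m a k + hasseCoeff m a' k := by
  simp [hasseCoeff]

theorem hasseCoeff_smul (m : ℕ) (c : K) (a : Distribution K V) (k : ℤ) :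
    hasseCoeff m (c • a) k = c • hasseCoeff m a k := by
  rw [hasseCoeff, Distribution.coeff_smul, smul_comm]; rfl

theorem hasseCoeff_mem (m : ℕ) (a : Distribution K V) (k : ℤ) : hasseCoeff m a k ∈ BEnd K V :=
  zsmul_mem (a.coeff_mem _) _

theorem nthTerm_mem (a b : Distribution K V) (n p k : ℤ) : nthTerm a b n p k ∈ BEnd K V := by
  cases n with
  | ofNat n =>
    simp only [nthTerm]
    split_ifs
    · exact sum_mem fun i _ => zsmul_mem (comm_mem_bEnd (a.coeff_mem _) (b.coeff_mem _)) _
    · exact zero_mem _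
  | negSucc m =>
    simp only [nthTerm]
    split_ifs
    · exact comp_mem_bEnd (hasseCoeff_mem m a k) (b.coeff_mem _)
    · exact comp_mem_bEnd (b.coeff_mem _) (hasseCoeff_mem m a k)

theorem nthTerm_map_smul (a b : Distribution K V) (n p k : ℤ) (c : K) (v : V) :
    nthTerm a b n p k (c • v) = c • nthTerm a b n p k v := nthTerm_mem a b n p k c v

theorem nthTerm_add_left (a a' b : Distribution K V) (n p k : ℤ) (v : V) :
    nthTerm (a + a') b n p k v = nthTerm a b n p k v + nthTerm a' b n p k v := by
  cases n with
  | ofNat n =>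
    simp only [nthTerm]
    split_ifs
    · simp only [NormedAddGroupHom.sum_apply, ← Finset.sum_add_distrib]
      refine Finset.sum_congr rfl fun i _ => ?_
      simp only [NormedAddGroupHom.zsmul_apply, ← smul_add]
      congr 1
      simp [comm_apply]
      abel
    · simp
  | negSucc m =>
    simp only [nthTerm, hasseCoeff_add]
    split_ifs <;> simp

theorem nthTerm_add_right (a b b' : Distribution K V) (n p k : ℤ) (v : V) :
    nthTerm a (b + b') n p k v = nthTerm a b n p k v + nthTerm a b' n p k v := by
  cases n with
  | ofNat n =>
    simp only [nthTerm]
    split_ifs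
    · simp only [NormedAddGroupHom.sum_apply, ← Finset.sum_add_distrib]
      refine Finset.sum_congr rfl fun i _ => ?_
      simp only [NormedAddGroupHom.zsmul_apply, ← smul_add]
      congr 1
      simp [comm_apply]
      abel
    · simp
  | negSucc m =>
    simp only [nthTerm]
    split_ifs <;> simp

theorem nthTerm_smul_left (c : K) (a b : Distribution K V) (n p k : ℤ) (v : V) :
    nthTerm (c • a) b n p k v = c • nthTerm a b n p k v := by
  cases n with
  | ofNat n =>
    simp only [nthTerm]
    split_ifs
    · simp only [NormedAddGroupHom.sum_apply, Finset.smul_sum]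
      refine Finset.sum_congr rfl fun i _ => ?_
      simp only [NormedAddGroupHom.zsmul_apply]
      rw [smul_comm c]
      congr 1
      simp [comm_apply, smul_sub, Distribution.coeff_map_smul]
    · simp
  | negSucc m =>
    simp only [nthTerm, hasseCoeff_smul]
    split_ifs <;> simp [Distribution.coeff_map_smul]

theorem nthTerm_smul_right (c : K) (a b : Distribution K V) (n p k : ℤ) (v : V) :
    nthTerm a (c • b) n p k v = c • nthTerm a b n p k v := by
  cases n with
  | ofNat n =>
    simp only [nthTerm]
    split_ifs
    · simp only [NormedAddGroupHom.sum_apply, Finset.smul_sum]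
      refine Finset.sum_congr rfl fun i _ => ?_
      simp only [NormedAddGroupHom.zsmul_apply]
      rw [smul_comm c]
      congr 1
      simp [comm_apply, smul_sub, Distribution.coeff_map_smul]
    · simp
  | negSucc m =>
    simp only [nthTerm]
    split_ifs
    · have := hasseCoeff_mem m a k c (b.coeff (p - 1 - k) v)
      simpa using this
    · simp

theorem IsNthProduct.add_left {a a' b c c' : Distribution K V} {n : ℤ}
    (h : IsNthProduct a b n c) (h' : IsNthProduct a' b n c') :
    IsNthProduct (a + a') b n (c + c') := by
  rw [isNthProduct_iff] at *
  intro p v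
  simp only [nthTerm_add_left]
  exact (h p v).add (h' p v)

theorem IsNthProduct.add_right {a b b' c c' : Distribution K V} {n : ℤ}
    (h : IsNthProduct a b n c) (h' : IsNthProduct a b' n c') :
    IsNthProduct a (b + b') n (c + c') := by
  rw [isNthProduct_iff] at *
  intro p v
  simp only [nthTerm_add_right]
  exact (h p v).add (h' p v)

theorem IsNthProduct.smul_left {a b c : Distribution K V} {n : ℤ} (r : K)
    (h : IsNthProduct a b n c) : IsNthProduct (r • a) b n (r • c) := by
  rw [isNthProduct_iff] at *
  intro p v
  simp only [nthTerm_smul_left]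
  exact (h p v).const_smul r

theorem IsNthProduct.smul_right {a b c : Distribution K V} {n : ℤ} (r : K)
    (h : IsNthProduct a b n c) : IsNthProduct a (r • b) n (r • c) := by
  rw [isNthProduct_iff] at *
  intro p v
  simp only [nthTerm_smul_right]
  exact (h p v).const_smul r

theorem IsNthProduct.unique {a b c c' : Distribution K V} {n : ℤ}
    (h : IsNthProduct a b n c) (h' : IsNthProduct a b n c') : c = c' := by
  rw [isNthProduct_iff] at *
  refine Distribution.ext_coeff fun p => ?_
  ext v
  exact (h p v).unique (h' p v)

variable [IsUltrametricDist V]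

theorem norm_nthTerm_le (a b : Distribution K V) (n p k : ℤ) :
    ‖nthTerm a b n p k‖ ≤ ‖a‖ * ‖b‖ := by
  have hh : ∀ m k, ‖hasseCoeff m a k‖ ≤ ‖a‖ := fun m k =>
    (IsUltrametricDist.norm_zsmul_le _ _).trans (a.norm_coeff_le _)
  cases n with
  | ofNat n =>
    simp only [nthTerm]
    split_ifs
    · exact IsUltrametricDist.norm_sum_le_of_forall_le_of_nonneg (by positivity) fun _ _ =>
        (IsUltrametricDist.norm_zsmul_le _ _).trans (norm_comm_coeff_le a b _ _)
    · simp only [NormedAddGroupHom.opNorm_zero]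
      positivity
  | negSucc m =>
    simp only [nthTerm]
    split_ifs
    · exact (NormedAddGroupHom.norm_comp_le _ _).trans
        (mul_le_mul (hh _ _) (b.norm_coeff_le _) (norm_nonneg _) (norm_nonneg _))
    · rw [mul_comm]
      exact (NormedAddGroupHom.norm_comp_le _ _).trans
        (mul_le_mul (b.norm_coeff_le _) (hh _ _) (norm_nonneg _) (norm_nonneg _))

/-- Each term of the series obeys this bound, and an ultrametric sum is no larger than its terms.
This is the continuity of the products. -/
theorem IsNthProduct.norm_le {a b c : Distribution K V} {n : ℤ} (h : IsNthProduct a b n c) :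
    ‖c‖ ≤ ‖a‖ * ‖b‖ := by
  rw [isNthProduct_iff] at h
  refine Distribution.norm_le (by positivity) fun p v => norm_le_of_hasSum (by positivity)
    (fun k => NormedAddGroupHom.le_of_opNorm_le _ (norm_nthTerm_le a b n p k) v) (h p v)

/-- For negative `n` the two ends use different hypotheses: as `k → -∞` the inner operator is
`b_{(p-1-k)}`, with index tending to `+∞`; as `k → +∞` it is a multiple of `a_{(k-m)}`. The outer
factor is only bounded. -/
theorem tendsto_nthTerm {a b : Distribution K V} (ha : a ∈ fieldSpace K V)
    (hb : b ∈ fieldSpace K V) (n p : ℤ) (v : V) :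
    Tendsto (fun k => nthTerm a b n p k v) cofinite (𝓝 0) := by
  rw [Int.cofinite_eq, tendsto_sup]
  cases n with
  | ofNat n =>
    simp only [nthTerm]
    constructor
    · refine tendsto_const_nhds.congr' ?_
      filter_upwards [eventually_lt_atBot (0 : ℤ)] with k hk
      rw [if_neg hk.ne]; rfl
    · refine tendsto_const_nhds.congr' ?_
      filter_upwards [eventually_gt_atTop (0 : ℤ)] with k hk
      rw [if_neg hk.ne']; rfl
  | negSucc m =>
    simp only [nthTerm]
    constructor
    · have h : Tendsto (fun k : ℤ => ‖a‖ * ‖b.coeff (p - 1 - k) v‖) atBot (𝓝 (‖a‖ * 0)) := by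
        refine Tendsto.const_mul _ (tendsto_zero_iff_norm_tendsto_zero.1 ((hb v).comp ?_))
        exact tendsto_atTop_add_const_left _ _ tendsto_neg_atBot_atTop
      rw [mul_zero] at h
      refine squeeze_zero_norm' ?_ h
      filter_upwards [eventually_lt_atBot (0 : ℤ)] with k hk
      rw [if_pos hk]
      exact NormedAddGroupHom.le_of_opNorm_le _
        ((IsUltrametricDist.norm_zsmul_le _ _).trans (a.norm_coeff_le _)) _
    · have h : Tendsto (fun k : ℤ => ‖b‖ * ‖a.coeff (k - m) v‖) atTop (𝓝 (‖b‖ * 0)) := by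
        refine Tendsto.const_mul _ (tendsto_zero_iff_norm_tendsto_zero.1 ((ha v).comp ?_))
        exact tendsto_atTop_add_const_right _ _ tendsto_id
      rw [mul_zero] at h
      refine squeeze_zero_norm' ?_ h
      filter_upwards [eventually_ge_atTop (0 : ℤ)] with k hk
      rw [if_neg hk.not_gt]
      refine (b.norm_coeff_apply_le _ _).trans ?_
      gcongr
      exact IsUltrametricDist.norm_zsmul_le _ _

/-- In a complete ultrametric group, terms tending to zero are summable; the bound on the terms
makes the pointwise sums a bounded distribution. -/
theorem exists_isNthProduct [CompleteSpace V] {a b : Distribution K V} (ha : a ∈ fieldSpace K V)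
    (hb : b ∈ fieldSpace K V) (n : ℤ) : ∃ c, IsNthProduct a b n c := by
  have hs : ∀ p v, Summable fun k => nthTerm a b n p k v := fun p v =>
    NonarchimedeanAddGroup.summable_of_tendsto_cofinite_zero (tendsto_nthTerm ha hb n p v)
  have hC : 0 ≤ ‖a‖ * ‖b‖ := by positivity
  have hbd : ∀ p v, ‖∑' k, nthTerm a b n p k v‖ ≤ ‖a‖ * ‖b‖ * ‖v‖ := fun p v =>
    norm_le_of_hasSum (by positivity)
      (fun k => NormedAddGroupHom.le_of_opNorm_le _ (norm_nthTerm_le a b n p k) v) (hs p v).hasSum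
  let F : ℤ → NormedAddGroupHom V V := fun p => AddMonoidHom.mkNormedAddGroupHom
    (AddMonoidHom.mk' (fun v => ∑' k, nthTerm a b n p k v) fun v w => by
      simp only [map_add]
      exact (hs p v).tsum_add (hs p w)) (‖a‖ * ‖b‖) (hbd p)
  refine ⟨Distribution.ofCoeff F (fun p c v => ?_) (‖a‖ * ‖b‖) fun p =>
    NormedAddGroupHom.opNorm_le_bound _ hC (hbd p), ?_⟩
  · change ∑' k, nthTerm a b n p k (c • v) = c • ∑' k, nthTerm a b n p k v
    simp only [nthTerm_map_smul]
    exact (((hs p v).hasSum).const_smul c).tsum_eq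
  · rw [isNthProduct_iff]
    exact fun p v => (hs p v).hasSum

/-- A bounded bilinear operation that sends pairs of generators into a closed submodule does so on
the closed span. The products are given as a relation, so the linearity steps first produce the
products of the summands and then use uniqueness. -/
theorem mem_of_isNthProduct_of_mem_closure_span [CompleteSpace V] {S : Set (Distribution K V)}
    {M : Submodule K (Distribution K V)} (hM : IsClosed (M : Set (Distribution K V)))
    (hS : S ⊆ fieldSpace K V) {n : ℤ}
    (h : ∀ a ∈ S, ∀ b ∈ S, ∀ c, IsNthProduct a b n c → c ∈ M) {a b : Distribution K V}
    (ha : a ∈ (Submodule.span K S).topologicalClosure)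
    (hb : b ∈ (Submodule.span K S).topologicalClosure) :
    ∀ c, IsNthProduct a b n c → c ∈ M := by
  have hle : (Submodule.span K S).topologicalClosure ≤ fieldSpace K V :=
    Submodule.topologicalClosure_minimal _ (Submodule.span_le.2 hS) isClosed_fieldSpace
  -- Here `C` will be the norm of the factor held fixed, which may be zero.
  have hlim : ∀ (c : Distribution K V) (C : ℝ), 0 ≤ C →
      (∀ ε, 0 < ε → ∃ d ∈ M, ‖c - d‖ ≤ ε * C) → c ∈ M := by
    intro c C hC hc
    rw [← SetLike.mem_coe, ← hM.closure_eq, Metric.mem_closure_iff]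
    intro ε hε
    obtain ⟨d, hd, hcd⟩ := hc (ε / (C + 1)) (by positivity)
    refine ⟨d, hd, ?_⟩
    rw [dist_eq_norm]
    refine hcd.trans_lt ?_
    rw [div_mul_eq_mul_div, div_lt_iff₀ (by positivity)]
    nlinarith
  have h1 : ∀ b ∈ S, ∀ a ∈ (Submodule.span K S).topologicalClosure,
      ∀ c, IsNthProduct a b n c → c ∈ M := by
    intro b hb a ha
    have hspan : ∀ a ∈ Submodule.span K S, ∀ c, IsNthProduct a b n c → c ∈ M := by
      intro a ha
      induction ha using Submodule.span_induction with
      | mem a ha => exact h a ha b hb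
      | zero =>
        intro c hc
        have := hc.norm_le
        simp only [norm_zero, zero_mul, norm_le_zero_iff] at this
        rw [this]
        exact M.zero_mem
      | add x y hx hy ihx ihy =>
        intro c hc
        obtain ⟨d, hd⟩ := exists_isNthProduct
          (hle (Submodule.le_topologicalClosure _ hx)) (hS hb) n
        obtain ⟨e, he⟩ := exists_isNthProduct
          (hle (Submodule.le_topologicalClosure _ hy)) (hS hb) n
        rw [hc.unique (hd.add_left he)]
        exact M.add_mem (ihx d hd) (ihy e he)
      | smul r x hx ih =>
        intro c hc
        obtain ⟨d, hd⟩ := exists_isNthProduct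
          (hle (Submodule.le_topologicalClosure _ hx)) (hS hb) n
        rw [hc.unique (hd.smul_left r)]
        exact M.smul_mem r (ih d hd)
    intro c hc
    refine hlim c ‖b‖ (norm_nonneg _) fun ε hε => ?_
    obtain ⟨a', ha', haa'⟩ := Metric.mem_closure_iff.1 ha ε hε
    obtain ⟨d, hd⟩ := exists_isNthProduct
      (hle (Submodule.le_topologicalClosure _ ha')) (hS hb) n
    refine ⟨d, hspan a' ha' d hd, ?_⟩
    -- `c - d` is the product of `a - a'` with `b`, so its norm is at most `‖a - a'‖ * ‖b‖`.
    have h2 := (hc.add_left (hd.smul_left (-1))).norm_le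
    rw [neg_one_smul, neg_one_smul, ← sub_eq_add_neg, ← sub_eq_add_neg, ← dist_eq_norm a a'] at h2
    exact h2.trans (by gcongr)
  have hspan : ∀ b ∈ Submodule.span K S, ∀ c, IsNthProduct a b n c → c ∈ M := by
    intro b hb
    induction hb using Submodule.span_induction with
    | mem b hb => exact h1 b hb a ha
    | zero =>
      intro c hc
      have := hc.norm_le
      simp only [norm_zero, mul_zero, norm_le_zero_iff] at this
      rw [this]
      exact M.zero_mem
    | add x y hx hy ihx ihy =>
      intro c hc
      obtain ⟨d, hd⟩ := exists_isNthProduct (hle ha)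
        (hle (Submodule.le_topologicalClosure _ hx)) n
      obtain ⟨e, he⟩ := exists_isNthProduct (hle ha)
        (hle (Submodule.le_topologicalClosure _ hy)) n
      rw [hc.unique (hd.add_right he)]
      exact M.add_mem (ihx d hd) (ihy e he)
    | smul r x hx ih =>
      intro c hc
      obtain ⟨d, hd⟩ := exists_isNthProduct (hle ha)
        (hle (Submodule.le_topologicalClosure _ hx)) n
      rw [hc.unique (hd.smul_right r)]
      exact M.smul_mem r (ih d hd)
  intro c hc
  refine hlim c ‖a‖ (norm_nonneg _) fun ε hε => ?_
  obtain ⟨b', hb', hbb'⟩ := Metric.mem_closure_iff.1 hb ε hε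
  obtain ⟨d, hd⟩ := exists_isNthProduct (hle ha)
    (hle (Submodule.le_topologicalClosure _ hb')) n
  refine ⟨d, hspan b' hb' d hd, ?_⟩
  have h2 := (hc.add_right (hd.smul_right (-1))).norm_le
  rw [neg_one_smul, neg_one_smul, ← sub_eq_add_neg, ← sub_eq_add_neg, ← dist_eq_norm b b'] at h2
  rw [mul_comm ε]
  exact h2.trans (by gcongr)

end Products

/-! ### The completed tensor product -/

section Tensor

variable {R K V : Type*} [NormedCommRing R] [NormedCommRing K] [Algebra R K]
  [NormedAddCommGroup V] [Module R V]

theorem PreTensor.norm_mk_le (x : K) (v : V) : ‖(PreTensor.mk x v : PreTensor R K V)‖ ≤ ‖x‖ * ‖v‖ :=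
  PreTensor.seminorm_le ⟨by positivity, [(x, v)], by simp, by simp⟩

theorem PreTensor.mk_add (x : K) (v w : V) :
    (PreTensor.mk x (v + w) : PreTensor R K V) = PreTensor.mk x v + PreTensor.mk x w :=
  TensorProduct.tmul_add x v w

theorem PreTensor.mk_smul (x : K) (r : R) (v : V) :
    (PreTensor.mk x (r • v) : PreTensor R K V) = algebraMap R K r • PreTensor.mk x v := by
  change x ⊗ₜ[R] (r • v) = algebraMap R K r • (x ⊗ₜ[R] v)
  rw [TensorProduct.tmul_smul, algebraMap_smul]

theorem PreTensor.smul_mk (c x : K) (v : V) :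
    c • (PreTensor.mk x v : PreTensor R K V) = PreTensor.mk (c * x) v :=
  TensorProduct.smul_tmul' c x v

theorem PreTensor.induction_on {p : PreTensor R K V → Prop} (t : PreTensor R K V)
    (zero : p 0) (mk : ∀ x v, p (PreTensor.mk x v)) (add : ∀ s t, p s → p t → p (s + t)) : p t :=
  TensorProduct.induction_on (motive := p) t zero mk add

instance : IsUltrametricDist (PreTensor R K V) :=
  IsUltrametricDist.isUltrametricDist_of_forall_norm_add_le_max_norm
    PreTensor.seminorm_add_le_max

instance : IsUltrametricDist (ExtScalars R K V) :=
  IsUltrametricDist.isUltrametricDist_of_forall_norm_add_le_max_norm fun x y => by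
    induction x, y using UniformSpace.Completion.induction_on₂ with
    | hp => exact isClosed_le (by fun_prop) (by fun_prop)
    | ih s t =>
      rw [← UniformSpace.Completion.coe_add]
      simp only [UniformSpace.Completion.norm_coe]
      exact IsUltrametricDist.norm_add_le_max s t

variable (R K) in
/-- The additive map `v ↦ x ⊗ v` into the completed tensor product. -/
def tensorLeft (x : K) : V →+ ExtScalars R K V :=
  (UniformSpace.Completion.toCompl : PreTensor R K V →+ ExtScalars R K V).comp
    (AddMonoidHom.mk' (PreTensor.mk x) (PreTensor.mk_add x))

theorem norm_tensorLeft_le (x : K) (v : V) : ‖tensorLeft R K x v‖ ≤ ‖x‖ * ‖v‖ :=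
  (UniformSpace.Completion.norm_coe _).trans_le (PreTensor.norm_mk_le x v)

theorem continuous_tensorLeft (x : K) : Continuous (tensorLeft R K x : V → ExtScalars R K V) :=
  AddMonoidHomClass.continuous_of_bound (tensorLeft R K x) ‖x‖ (norm_tensorLeft_le x)

theorem tensorLeft_smul (x : K) (r : R) (v : V) :
    tensorLeft R K x (r • v) = algebraMap R K r • tensorLeft R K x v := by
  change ((PreTensor.mk x (r • v) : PreTensor R K V) : ExtScalars R K V) =
    algebraMap R K r • ((PreTensor.mk x v : PreTensor R K V) : ExtScalars R K V)
  rw [← UniformSpace.Completion.coe_smul, PreTensor.mk_smul]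

theorem smul_tensorLeft (c x : K) (v : V) :
    c • tensorLeft R K x v = tensorLeft R K (c * x) v := by
  change c • ((PreTensor.mk x v : PreTensor R K V) : ExtScalars R K V) =
    ((PreTensor.mk (c * x) v : PreTensor R K V) : ExtScalars R K V)
  rw [← UniformSpace.Completion.coe_smul, PreTensor.smul_mk]

/-- A closed subset of the completed tensor product that is stable under addition and contains the
elementary tensors is everything. -/
theorem ExtScalars.induction_on {p : ExtScalars R K V → Prop} (x : ExtScalars R K V)
    (closed : IsClosed {x | p x}) (tensor : ∀ c v, p (tensorLeft R K c v))
    (add : ∀ x y, p x → p y → p (x + y)) : p x := by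
  induction x using UniformSpace.Completion.induction_on with
  | hp => exact closed
  | ih t =>
    induction t using PreTensor.induction_on with
    | zero =>
      have := tensor 0 0
      rwa [map_zero] at this
    | mk c v => exact tensor c v
    | add s t hs ht =>
      rw [UniformSpace.Completion.coe_add]
      exact add _ _ hs ht

theorem ExtScalars.hom_ext {W : Type*} [NormedAddCommGroup W]
    {f g : NormedAddGroupHom (ExtScalars R K V) W}
    (h : ∀ x v, f (tensorLeft R K x v) = g (tensorLeft R K x v)) : f = g := by
  ext x
  induction x using ExtScalars.induction_on with
  | closed => exact isClosed_eq f.continuous g.continuous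
  | tensor c v => exact h c v
  | add x y hx hy => rw [map_add, map_add, hx, hy]

/-! ### Coordinates -/

section Coordinates

variable {ι : Type*} (B : Module.Basis ι R V)

/-- The coordinates of an element of `K ⊗ V` with respect to a basis of `V`. -/
def PreTensor.coord (i : ι) : PreTensor R K V →ₗ[K] K := (B.baseChange K).coord i

theorem PreTensor.coord_mk (i : ι) (x : K) (v : V) :
    PreTensor.coord B i (PreTensor.mk x v) = x * algebraMap R K (B.repr v i) := by
  change (B.baseChange K).repr (x ⊗ₜ[R] v) i = _
  rw [Module.Basis.baseChange_repr_tmul, Algebra.smul_def, mul_comm]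

variable [IsUltrametricDist K] (hBK : ∀ v i, ‖algebraMap R K (B.repr v i)‖ ≤ ‖v‖)

include hBK in
-- In any presentation by elementary tensors, the coordinate of `x ⊗ v` has norm at most `‖x‖ *
-- ‖v‖`; the ultrametric inequality bounds the sum, and the infimum over presentations is the norm.
theorem PreTensor.norm_coord_le (i : ι) (t : PreTensor R K V) : ‖PreTensor.coord B i t‖ ≤ ‖t‖ := by
  refine le_of_forall_pos_le_add fun ε hε => ?_
  obtain ⟨c, ⟨hc, l, rfl, hl⟩, hlt⟩ := t.exists_lt hε
  refine le_trans ?_ hlt.le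
  clear hlt
  induction l with
  | nil => simpa using hc
  | cons p l ih =>
    rw [List.map_cons, List.sum_cons, map_add]
    refine (IsUltrametricDist.norm_add_le_max _ _).trans (max_le ?_ ?_)
    · rw [PreTensor.coord_mk]
      refine (norm_mul_le _ _).trans (le_trans ?_ (hl p (by simp)))
      gcongr
      exact hBK _ _
    · exact ih fun q hq => hl q (List.mem_cons_of_mem _ hq)

variable [CompleteSpace K]

/-- The coordinates of an element of the completed tensor product with respect to a basis. -/
def coord (i : ι) : NormedAddGroupHom (ExtScalars R K V) K :=
  ((PreTensor.coord B i).toAddMonoidHom.mkNormedAddGroupHom 1 fun t => by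
    rw [one_mul]; exact PreTensor.norm_coord_le B hBK i t).extension

theorem coord_coe (i : ι) (t : PreTensor R K V) :
    coord B hBK i (t : ExtScalars R K V) = PreTensor.coord B i t :=
  NormedAddGroupHom.extension_coe _ _

theorem coord_tensorLeft (i : ι) (x : K) (v : V) :
    coord B hBK i (tensorLeft R K x v) = x * algebraMap R K (B.repr v i) :=
  (coord_coe B hBK i _).trans (PreTensor.coord_mk B i x v)

theorem coord_smul (i : ι) (c : K) (x : ExtScalars R K V) :
    coord B hBK i (c • x) = c * coord B hBK i x := by
  induction x using ExtScalars.induction_on with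
  | closed =>
    exact isClosed_eq ((coord B hBK i).continuous.comp (continuous_const_smul c))
      (continuous_const.mul (coord B hBK i).continuous)
  | tensor d v => rw [smul_tensorLeft, coord_tensorLeft, coord_tensorLeft, mul_assoc]
  | add x y hx hy => rw [smul_add, map_add, map_add, hx, hy, mul_add]

theorem norm_coord_le (i : ι) (x : ExtScalars R K V) : ‖coord B hBK i x‖ ≤ ‖x‖ := by
  induction x using UniformSpace.Completion.induction_on with
  | hp => exact isClosed_le (coord B hBK i).continuous.norm continuous_norm
  | ih t =>
    rw [coord_coe, UniformSpace.Completion.norm_coe]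
    exact PreTensor.norm_coord_le B hBK i t

/-- On the algebraic tensor product, the expansion in the basis is itself a presentation that
realises the bound. A general element is approximated by an algebraic one, whose coordinates are
nearly the same. -/
theorem norm_le_of_coord_le (hB : ∀ i, ‖B i‖ ≤ 1) {x : ExtScalars R K V} {C : ℝ} (hC : 0 ≤ C)
    (h : ∀ i, ‖coord B hBK i x‖ ≤ C) : ‖x‖ ≤ C := by
  have hpre : ∀ (t : PreTensor R K V) (C : ℝ), 0 ≤ C → (∀ i, ‖PreTensor.coord B i t‖ ≤ C) →
      ‖t‖ ≤ C := by
    intro t C hC h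
    have ht : t = ∑ i ∈ ((B.baseChange K).repr t).support,
        (PreTensor.mk (PreTensor.coord B i t) (B i) : PreTensor R K V) := by
      refine ((B.baseChange K).linearCombination_repr t).symm.trans ?_
      rw [Finsupp.linearCombination_apply]
      refine Finset.sum_congr rfl fun i _ => ?_
      refine (congrArg (PreTensor.coord B i t • ·) (Module.Basis.baseChange_apply K B i)).trans ?_
      exact (PreTensor.smul_mk _ _ _).trans (by rw [mul_one])
    rw [ht]
    refine IsUltrametricDist.norm_sum_le_of_forall_le_of_nonneg hC fun i _ => ?_
    refine (PreTensor.norm_mk_le _ _).trans ?_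
    exact (mul_le_mul (h i) (hB i) (norm_nonneg _) hC).trans_eq (mul_one C)
  -- With `C < ε`, the midpoint `(C + ε) / 2` is a positive distance for the approximation and still
  -- exceeds the bound on the coordinates of `x`, so `t` satisfies it too.
  refine le_of_forall_gt fun ε hε => ?_
  have hε0 : 0 < ε := hC.trans_lt hε
  obtain ⟨_, ⟨t, rfl⟩, ht⟩ := Metric.mem_closure_iff.1
    (UniformSpace.Completion.denseRange_coe (α := PreTensor R K V) x) ((C + ε) / 2) (by linarith)
  rw [dist_eq_norm] at ht
  have h2 : ‖t‖ ≤ (C + ε) / 2 := hpre t _ (by linarith) fun i => by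
    have h3 : PreTensor.coord B i t = coord B hBK i x - coord B hBK i (x - t) := by
      rw [map_sub, coord_coe, sub_sub_cancel]
    rw [h3, sub_eq_add_neg]
    refine (IsUltrametricDist.norm_add_le_max _ _).trans (max_le ((h i).trans (by linarith)) ?_)
    rw [norm_neg]
    exact (norm_coord_le B hBK i _).trans ht.le
  have h4 : x = (x - t) + t := by simp
  rw [h4]
  refine (IsUltrametricDist.norm_add_le_max _ _).trans_lt (max_lt (by linarith) ?_)
  rw [UniformSpace.Completion.norm_coe]
  linarith

theorem eq_of_coord_eq (hB : ∀ i, ‖B i‖ ≤ 1) {x y : ExtScalars R K V}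
    (h : ∀ i, coord B hBK i x = coord B hBK i y) : x = y := by
  rw [← sub_eq_zero, ← norm_le_zero_iff]
  exact norm_le_of_coord_le B hBK hB le_rfl fun i => by rw [map_sub, h, sub_self, norm_zero]

include hBK in
theorem isAddTorsionFree_extScalars [IsAddTorsionFree K] (hB : ∀ i, ‖B i‖ ≤ 1) :
    IsAddTorsionFree (ExtScalars R K V) where
  nsmul_right_injective n hn x y hxy := eq_of_coord_eq B hBK hB fun i => by
    have := congrArg (coord B hBK i) hxy
    simp only [map_nsmul] at this
    exact nsmul_right_injective hn this

include hBK in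
theorem isTorsionFree_extScalars (hB : ∀ i, ‖B i‖ ≤ 1) :
    Module.IsTorsionFree K (ExtScalars R K V) where
  isSMulRegular r hr x y hxy := eq_of_coord_eq B hBK hB fun i => by
    have := congrArg (coord B hBK i) hxy
    simp only [coord_smul] at this
    exact hr.1 this

include hBK in
theorem norm_le_norm_smul (hB : ∀ i, ‖B i‖ ≤ 1) {c : K} (hc : ∀ x : K, ‖x‖ ≤ ‖c * x‖)
    (x : ExtScalars R K V) : ‖x‖ ≤ ‖c • x‖ :=
  norm_le_of_coord_le B hBK hB (norm_nonneg _) fun i =>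
    (hc _).trans (by rw [← coord_smul]; exact norm_coord_le B hBK i _)

end Coordinates

/-! ### Extension of operators and distributions -/

section Extension

/-- `g` is the extension of `f` to the completed tensor product. -/
def Extends (f : NormedAddGroupHom V V)
    (g : NormedAddGroupHom (ExtScalars R K V) (ExtScalars R K V)) : Prop :=
  ∀ x v, g (tensorLeft R K x v) = tensorLeft R K x (f v)

variable {f f' : NormedAddGroupHom V V}
  {g g' : NormedAddGroupHom (ExtScalars R K V) (ExtScalars R K V)}

theorem Extends.unique (h : Extends f g) (h' : Extends f g') : g = g' :=
  ExtScalars.hom_ext fun x v => (h x v).trans (h' x v).symm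

theorem Extends.zero : Extends (R := R) (K := K) (0 : NormedAddGroupHom V V) 0 := fun x _ =>
  (map_zero (tensorLeft R K x)).symm

theorem Extends.add (h : Extends f g) (h' : Extends f' g') : Extends (f + f') (g + g') :=
  fun x v => by
    rw [NormedAddGroupHom.add_apply, NormedAddGroupHom.add_apply, h, h', map_add]

theorem Extends.sub (h : Extends f g) (h' : Extends f' g') : Extends (f - f') (g - g') :=
  fun x v => by
    rw [NormedAddGroupHom.sub_apply, NormedAddGroupHom.sub_apply, h, h', map_sub]

theorem Extends.zsmul (h : Extends f g) (n : ℤ) : Extends (n • f) (n • g) := fun x v => by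
  rw [NormedAddGroupHom.zsmul_apply, NormedAddGroupHom.zsmul_apply, h, map_zsmul]

theorem Extends.comp (h : Extends f g) (h' : Extends f' g') : Extends (f.comp f') (g.comp g') :=
  fun x v => by
    rw [NormedAddGroupHom.comp_apply, NormedAddGroupHom.comp_apply, h', h]

theorem Extends.comm (h : Extends f g) (h' : Extends f' g') :
    Extends (NAVertex.comm f f') (NAVertex.comm g g') :=
  (h.comp h').sub (h'.comp h)

theorem Extends.sum {ι : Type*} (s : Finset ι) {f : ι → NormedAddGroupHom V V}
    {g : ι → NormedAddGroupHom (ExtScalars R K V) (ExtScalars R K V)}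
    (h : ∀ i, Extends (f i) (g i)) : Extends (∑ i ∈ s, f i) (∑ i ∈ s, g i) := fun x v => by
  rw [NormedAddGroupHom.sum_apply, NormedAddGroupHom.sum_apply, map_sum]
  exact Finset.sum_congr rfl fun i _ => h i x v

variable [IsBoundedSMul R V]

theorem extends_extendEnd (f : BEnd R V) : Extends f.1 (extendEnd K f).1 := fun x v =>
  extendEnd_coe K f x v

theorem extends_coeff (a : Distribution R V) (n : ℤ) :
    Extends (a.coeff n) ((extendDistribution K a).coeff n) :=
  extends_extendEnd _

theorem Extends.norm_le (hf : f ∈ BEnd R V) (h : Extends f g) : ‖g‖ ≤ ‖f‖ := by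
  rw [h.unique (extends_extendEnd (K := K) ⟨f, hf⟩)]
  exact norm_extendEnd_le K ⟨f, hf⟩

theorem extends_localityCoeff (a b : Distribution R V) (N : ℕ) (m n : ℤ) :
    Extends (localityCoeff a b N m n)
      (localityCoeff (extendDistribution K a) (extendDistribution K b) N m n) :=
  Extends.sum _ fun _ => ((extends_coeff a _).comm (extends_coeff b _)).zsmul _

theorem extends_nthTerm (a b : Distribution R V) (n p k : ℤ) :
    Extends (nthTerm a b n p k)
      (nthTerm (extendDistribution K a) (extendDistribution K b) n p k) := by
  cases n with
  | ofNat n =>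
    simp only [nthTerm]
    split_ifs
    · exact Extends.sum _ fun _ => ((extends_coeff a _).comm (extends_coeff b _)).zsmul _
    · exact Extends.zero
  | negSucc m =>
    simp only [nthTerm, hasseCoeff]
    split_ifs
    · exact ((extends_coeff a _).zsmul _).comp (extends_coeff b _)
    · exact (extends_coeff b _).comp ((extends_coeff a _).zsmul _)

theorem extendDistribution_add (a b : Distribution R V) :
    extendDistribution K (a + b) = extendDistribution K a + extendDistribution K b :=
  Distribution.ext_coeff fun n => (extends_coeff (a + b) n).unique
    ((extends_coeff a n).add (extends_coeff b n))

theorem extendDistribution_smul (r : R) (a : Distribution R V) :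
    extendDistribution K (r • a) = algebraMap R K r • extendDistribution K a :=
  Distribution.ext_coeff fun n => (extends_coeff (r • a) n).unique fun x v => by
    rw [Distribution.coeff_smul, NormedAddGroupHom.smul_apply, extends_coeff,
      Distribution.coeff_smul, NormedAddGroupHom.smul_apply, tensorLeft_smul]

theorem extendDistribution_sum {ι : Type*} (s : Finset ι) (a : ι → Distribution R V) :
    extendDistribution K (∑ i ∈ s, a i) = ∑ i ∈ s, extendDistribution K (a i) :=
  map_sum (AddMonoidHom.mk' (extendDistribution K) extendDistribution_add) a s

theorem extendDistribution_idField : extendDistribution K (idField R V) = idField K _ :=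
  Distribution.ext_coeff fun n => by
    refine (extends_coeff (idField R V) n).unique fun x v => ?_
    simp only [Distribution.coeff, idField]
    split_ifs
    · rfl
    · exact (map_zero (tensorLeft R K x)).symm

theorem norm_extendDistribution_le (a : Distribution R V) : ‖extendDistribution K a‖ ≤ ‖a‖ :=
  lp.norm_le_of_forall_le (norm_nonneg a) fun n =>
    (norm_extendEnd_le K _).trans (a.norm_coeff_le n)

/-- Continuity of `v ↦ c ⊗ v` settles elementary tensors; the uniform bound on the coefficients
makes the set of good vectors closed. -/
theorem extendDistribution_mem_fieldSpace {a : Distribution R V} (ha : a ∈ fieldSpace R V) :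
    extendDistribution K a ∈ fieldSpace K (ExtScalars R K V) := by
  intro x
  induction x using ExtScalars.induction_on with
  | closed =>
    refine isClosed_of_closure_subset fun x hx => ?_
    rw [Set.mem_ofPred_eq, Metric.tendsto_nhds]
    intro ε hε
    obtain ⟨y, hy, hxy⟩ := Metric.mem_closure_iff.1 hx (ε / 2 / (‖a‖ + 1)) (by positivity)
    filter_upwards [Metric.tendsto_nhds.1 hy (ε / 2) (by positivity)] with n hn
    rw [dist_zero_right] at hn ⊢
    rw [dist_eq_norm] at hxy
    have h1 : ‖(extendDistribution K a).coeff n (x - y)‖ ≤ ε / 2 := by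
      refine ((extendDistribution K a).norm_coeff_apply_le n _).trans ?_
      calc ‖extendDistribution K a‖ * ‖x - y‖ ≤ (‖a‖ + 1) * (ε / 2 / (‖a‖ + 1)) := by
            gcongr
            exact (norm_extendDistribution_le a).trans (by linarith)
        _ = ε / 2 := by field_simp
    rw [← sub_add_cancel x y, map_add]
    exact (norm_add_le _ _).trans_lt (by linarith)
  | tensor c v =>
    simp only [extends_coeff a _ c v]
    have := ((continuous_tensorLeft (R := R) (V := V) c).tendsto 0).comp (ha v)
    rwa [map_zero] at this
  | add x y hx hy =>
    simp only [map_add]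
    have := hx.add hy
    rwa [add_zero] at this

theorem IsNthProduct.extendDistribution [IsUltrametricDist V] {a b c : Distribution R V} {n : ℤ}
    (ha : a ∈ fieldSpace R V) (hb : b ∈ fieldSpace R V) (h : IsNthProduct a b n c) :
    IsNthProduct (NAVertex.extendDistribution K a) (NAVertex.extendDistribution K b) n
      (NAVertex.extendDistribution K c) := by
  -- The product on `V_K` is known to exist beforehand, so it need only be compared with the
  -- extension of `c` on elementary tensors; convergence on other vectors comes with `d`.
  obtain ⟨d, hd⟩ := exists_isNthProduct (extendDistribution_mem_fieldSpace (K := K) ha)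
    (extendDistribution_mem_fieldSpace (K := K) hb) n
  have hcd : NAVertex.extendDistribution K c = d := by
    refine Distribution.ext_coeff fun p => (extends_coeff c p).unique fun x v => ?_
    rw [isNthProduct_iff] at h hd
    refine (hd p (tensorLeft R K x v)).unique ?_
    have h1 := (h p v).map (tensorLeft R K x) (continuous_tensorLeft x)
    refine (congrArg (HasSum · _) (funext fun k => ?_)).mpr h1
    exact extends_nthTerm a b n p k x v
  rwa [hcd]

theorem TranslationCovariant.extendDistribution {T : BEnd R V} {a : Distribution R V}
    (h : TranslationCovariant T a) :
    TranslationCovariant (extendEnd K T) (NAVertex.extendDistribution K a) := fun n => by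
  have h1 := (extends_extendEnd (K := K) T).comm (extends_coeff (K := K) a n)
  rw [h n] at h1
  exact h1.unique ((extends_coeff a (n - 1)).zsmul (-n))

theorem MutuallyLocal.extendDistribution {a b : Distribution R V} (h : MutuallyLocal a b) :
    MutuallyLocal (NAVertex.extendDistribution K a) (NAVertex.extendDistribution K b) :=
  fun ε hε => by
    obtain ⟨N, hN⟩ := h ε hε
    refine ⟨N, fun M hM m n => le_trans ?_ (hN M hM m n)⟩
    exact Extends.norm_le (sum_mem fun _ _ =>
      zsmul_mem (comm_mem_bEnd (a.coeff_mem _) (b.coeff_mem _)) _) (extends_localityCoeff a b M m n)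

end Extension

end Tensor

/-! ### Consequences of the axioms for the trivial norm -/

section Trivial

variable {R V : Type*} [NormedCommRing R] [NormedAddCommGroup V] [Module R V] [IsBoundedSMul R V]

theorem Distribution.norm_le_one (hV : ∀ v : V, v ≠ 0 → ‖v‖ = 1) (a : Distribution R V) :
    ‖a‖ ≤ 1 :=
  Distribution.norm_le zero_le_one fun n v => by
    by_cases hv : v = 0
    · simp [hv]
    rw [hV v hv, mul_one]
    by_cases ha : a.coeff n v = 0
    · simp [ha]
    · exact (hV _ ha).le

variable {D : VertexData R V} (hD : D.IsVertexAlgebra)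

include hD

/-- Since `T` kills the vacuum, translation covariance gives `T a_{(n)}|0⟩ = -n a_{(n-1)}|0⟩`. Going
down from `n = -1`, the factor `-n` is never zero and can be cancelled by additive torsion-freeness.
-/
theorem VertexData.IsVertexAlgebra.coeff_vacuum_eq_zero {a : Distribution R V} (ha : a ∈ D.Fld)
    (h : a.coeff (-1) D.vacuum = 0) (n : ℤ) : a.coeff n D.vacuum = 0 := by
  rcases le_or_gt 0 n with hn | hn
  · exact hD.vacuum_axiom a ha n hn
  obtain ⟨k, rfl⟩ : ∃ k : ℕ, n = -1 - k := ⟨(-1 - n).toNat, by omega⟩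
  clear hn
  induction k with
  | zero => simpa using h
  | succ k ih =>
    have h1 := DFunLike.congr_fun (hD.translation a ha (-1 - k)) D.vacuum
    rw [comm_apply, hD.T_vacuum, ih, map_zero, map_zero, sub_zero,
      NormedAddGroupHom.zsmul_apply] at h1
    have := hD.addTorsionFree
    rcases smul_eq_zero.1 h1.symm with h2 | h2
    · omega
    · rw [← h2]
      congr 2
      push_cast
      ring

/-- Goddard's uniqueness argument: a field that annihilates the vacuum annihilates the image of
the field-state homomorphism. -/
theorem VertexData.IsVertexAlgebra.coeff_fs_eq_zero (hV : ∀ v : V, v ≠ 0 → ‖v‖ = 1)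
    {a : Distribution R V} (ha : a ∈ D.Fld)
    (h : a.coeff (-1) D.vacuum = 0) (b : D.Fld) (m : ℤ) : a.coeff m (D.fs b) = 0 := by
  -- For the trivial norm, any bound below 1 forces the operator to vanish, so locality holds in the
  -- ordinary sense.
  obtain ⟨N, hN⟩ := hD.locality a ha b.1 b.2 (1 / 2) (by norm_num)
  have h1 : localityCoeff a b.1 N (m - N) (-1) D.vacuum = 0 := by
    by_contra hne
    have hvac : D.vacuum ≠ 0 := fun h0 => hne (by rw [h0, map_zero])
    have h2 := NormedAddGroupHom.le_of_opNorm_le _ (hN N le_rfl (m - N) (-1)) D.vacuum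
    rw [hV _ hne, hV _ hvac] at h2
    norm_num at h2
  -- The indices `m - N` and `-1` make the term `j = 0` equal to `[a_{(m)}, b_{(-1)}]|0⟩`. For `j ≥
  -- 1` the operator `b_{(j-1)}` kills the vacuum, and `a` kills it throughout.
  rw [localityCoeff, NormedAddGroupHom.sum_apply, Finset.sum_eq_single 0] at h1
  · rw [NormedAddGroupHom.zsmul_apply, comm_apply, hD.coeff_vacuum_eq_zero ha h, map_zero,
      sub_zero] at h1
    have h2 : a.coeff m (b.1.coeff (-1) D.vacuum) = 0 := by simpa using h1
    exact h2
  · intro j _ hj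
    rw [NormedAddGroupHom.zsmul_apply, comm_apply, hD.coeff_vacuum_eq_zero ha h, map_zero,
      hD.vacuum_axiom b.1 b.2 _ (by omega), map_zero, sub_zero, smul_zero]
  · simp

/-- The trivial norm makes `V` discrete, so a dense subset is everything. -/
theorem VertexData.IsVertexAlgebra.exists_smul_mem_range (hV : ∀ v : V, v ≠ 0 → ‖v‖ = 1) (v : V) :
    ∃ r : R, r ≠ 0 ∧ r • v ∈ LinearMap.range D.fs := by
  obtain ⟨w, hw, hvw⟩ := Metric.mem_closure_iff.1 (hD.dense v) 1 one_pos
  have : v = w := by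
    by_contra hne
    rw [dist_eq_norm, hV _ (sub_ne_zero.2 hne)] at hvw
    exact lt_irrefl _ hvw
  rwa [this]

theorem VertexData.IsVertexAlgebra.fs_injective [IsDomain R] (hV : ∀ v : V, v ≠ 0 → ‖v‖ = 1) :
    Function.Injective D.fs := by
  rw [← LinearMap.ker_eq_bot, LinearMap.ker_eq_bot']
  intro a ha
  refine Subtype.ext (Distribution.ext_coeff fun n => ?_)
  ext v
  obtain ⟨r, hr, b, hb⟩ := hD.exists_smul_mem_range hV v
  have h1 := hD.coeff_fs_eq_zero hV a.2 ha b n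
  rw [hb, Distribution.coeff_map_smul] at h1
  have := hD.torsionFree
  exact (smul_eq_zero.1 h1).resolve_left hr

end Trivial

/-! ### Extension of scalars of vertex algebras -/

/-- All representatives of a class modulo the kernel have the same image, hence the same norm, which
is therefore the quotient norm. -/
theorem isAdmissibleHom_of_norm_eq {K U W : Type*} [NormedCommRing K] [NormedAddCommGroup U]
    [Module K U] [NormedAddCommGroup W] [Module K W] (φ : U →ₗ[K] W) (hφ : ∀ u, ‖φ u‖ = ‖u‖) :
    IsAdmissibleHom φ := by
  have h : ∀ u : U, ‖(Submodule.Quotient.mk u : U ⧸ LinearMap.ker φ)‖ = ‖φ u‖ := by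
    intro u
    refine le_antisymm ((Submodule.Quotient.norm_mk_le _ u).trans_eq (hφ u).symm) ?_
    refine le_of_forall_pos_le_add fun ε hε => ?_
    obtain ⟨w, hw, hwε⟩ := Submodule.Quotient.norm_mk_lt
      (Submodule.Quotient.mk u : U ⧸ LinearMap.ker φ) hε
    have h1 : φ w = φ u := by
      rw [← sub_eq_zero, ← map_sub]
      exact (Submodule.Quotient.eq _).1 hw
    rw [← h1, hφ]
    exact hwε.le
  refine ⟨⟨1, fun u => by rw [one_mul, hφ]⟩, 1, 1, one_pos, one_pos, fun u => ?_⟩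
  rw [h, one_mul]
  exact ⟨le_rfl, le_rfl⟩

section ExtendScalars

variable {R K V : Type*} [NormedCommRing R] [NormedCommRing K] [Algebra R K]
  [NormedAddCommGroup V] [Module R V] [IsBoundedSMul R V] {D : VertexData R V}

theorem VertexData.coeff_extendDistribution_vacuum (a : D.Fld) :
    (extendDistribution K a.1).coeff (-1) (D.extendScalars K).vacuum =
      tensorLeft R K 1 (D.fs a) :=
  extends_coeff a.1 (-1) 1 D.vacuum

/-- If multiples of all vectors by scalars that do not decrease norms in `K` are in the image of the
field-state homomorphism, then one such scalar serves finitely many vectors. -/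
theorem VertexData.exists_smul_mem_range_of_finset {ι : Type*} (B : ι → V)
    (hgood : ∀ v : V, ∃ r : R, (∀ x : K, ‖x‖ ≤ ‖algebraMap R K r * x‖) ∧
      r • v ∈ LinearMap.range D.fs) (s : Finset ι) :
    ∃ r : R, (∀ x : K, ‖x‖ ≤ ‖algebraMap R K r * x‖) ∧
      ∀ i ∈ s, r • B i ∈ LinearMap.range D.fs := by
  classical
  induction s using Finset.induction_on with
  | empty => exact ⟨1, fun x => by simp, by simp⟩
  | insert i s _ ih =>
    obtain ⟨r, hr, hrs⟩ := ih
    obtain ⟨q, hq, hqi⟩ := hgood (B i)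
    refine ⟨r * q, fun x => ?_, fun j hj => ?_⟩
    · rw [map_mul, mul_assoc]
      exact (hq x).trans (hr _)
    · rcases Finset.mem_insert.1 hj with rfl | hj
      · rw [mul_smul]
        exact Submodule.smul_mem _ _ hqi
      · rw [mul_comm, mul_smul]
        exact Submodule.smul_mem _ _ (hrs j hj)

section Coordinates

variable [CompleteSpace K] [IsUltrametricDist K] {ι : Type*} (B : Module.Basis ι R V)
  (hBK : ∀ v i, ‖algebraMap R K (B.repr v i)‖ ≤ ‖v‖)

/-- Both sides are `K`-linear in `a`, so it suffices to treat the extension of a field of `V`; there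
the identity holds in `Fld(V)` because both sides have the same image under the injective `fs`.
Allowing every `s ⊇ s₀` lets the finite sets of two summands be merged, and `r` comes after `s`
because it is chosen to serve all of `s`. -/
theorem VertexData.smul_eq_sum_coord_smul (hinj : Function.Injective D.fs)
    {a : Distribution K (ExtScalars R K V)} (ha : a ∈ Submodule.span K
      (extendDistribution K '' (D.Fld : Set (Distribution R V)))) :
    ∃ s₀ : Finset ι, ∀ s, s₀ ⊆ s → ∀ (r : R) (c : ι → D.Fld), (∀ i ∈ s, D.fs (c i) = r • B i) →
      algebraMap R K r • a = ∑ i ∈ s,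
        coord B hBK i (a.coeff (-1) (D.extendScalars K).vacuum) • extendDistribution K (c i).1 := by
  classical
  induction ha using Submodule.span_induction with
  | mem a ha =>
    obtain ⟨a, ha, rfl⟩ := ha
    refine ⟨(B.repr (D.fs ⟨a, ha⟩)).support, fun s hs r c hc => ?_⟩
    have h1 : r • (⟨a, ha⟩ : D.Fld) = ∑ i ∈ s, B.repr (D.fs ⟨a, ha⟩) i • c i := by
      apply hinj
      rw [map_smul, map_sum]
      conv_lhs => rw [← B.linearCombination_repr (D.fs ⟨a, ha⟩), Finsupp.linearCombination_apply,
        Finsupp.sum_of_support_subset _ hs _ (by simp), Finset.smul_sum]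
      refine Finset.sum_congr rfl fun i hi => ?_
      rw [map_smul, hc i hi, smul_comm]
    have h2 := congrArg (fun b : D.Fld => extendDistribution K b.1) h1
    simp only [Submodule.coe_smul, Submodule.coe_sum, extendDistribution_sum,
      extendDistribution_smul] at h2
    rw [h2]
    refine Finset.sum_congr rfl fun i _ => ?_
    rw [VertexData.coeff_extendDistribution_vacuum ⟨a, ha⟩, coord_tensorLeft, one_mul]
  | zero => exact ⟨∅, fun s _ r c _ => by simp⟩
  | add a b _ _ iha ihb =>
    obtain ⟨s, hs⟩ := iha
    obtain ⟨t, ht⟩ := ihb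
    refine ⟨s ∪ t, fun u hu r c hc => ?_⟩
    rw [smul_add, hs u (Finset.union_subset_left hu) r c hc,
      ht u (Finset.union_subset_right hu) r c hc, ← Finset.sum_add_distrib]
    refine Finset.sum_congr rfl fun i _ => ?_
    rw [Distribution.coeff_add, NormedAddGroupHom.add_apply, map_add, add_smul]
  | smul k a _ ih =>
    obtain ⟨s, hs⟩ := ih
    refine ⟨s, fun u hu r c hc => ?_⟩
    rw [smul_comm, hs u hu r c hc, Finset.smul_sum]
    refine Finset.sum_congr rfl fun i _ => ?_
    rw [Distribution.coeff_smul, NormedAddGroupHom.smul_apply, coord_smul, mul_smul]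

end Coordinates

variable (hD : D.IsVertexAlgebra)

include hD

variable (K) in
-- The extended fields are already closed under products, as extension commutes with products, and
-- they contain the identity. Hence their closed span is stable under products and nothing more is
-- generated.
theorem VertexData.IsVertexAlgebra.extendScalars_fld_eq :
    (D.extendScalars K).Fld = (Submodule.span K
      (extendDistribution K '' (D.Fld : Set (Distribution R V)))).topologicalClosure := by
  have := hD.ultrametric
  have hsub : extendDistribution K '' (D.Fld : Set (Distribution R V)) ⊆
      fieldSpace K (ExtScalars R K V) := by
    rintro _ ⟨a, ha, rfl⟩
    exact extendDistribution_mem_fieldSpace (hD.fld_le ha)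
  refine le_antisymm ?_ ?_
  · refine Submodule.topologicalClosure_minimal _ (sInf_le ⟨?_, ?_, ?_, ?_⟩)
      (Submodule.isClosed_topologicalClosure _)
    · exact Submodule.topologicalClosure_minimal _ (Submodule.span_le.2 hsub) isClosed_fieldSpace
    · exact Submodule.subset_span.trans (Submodule.le_topologicalClosure _)
    · rw [← extendDistribution_idField]
      exact Submodule.le_topologicalClosure _ (Submodule.subset_span ⟨_, hD.id_mem, rfl⟩)
    · intro a ha b hb n
      refine mem_of_isNthProduct_of_mem_closure_span (Submodule.isClosed_topologicalClosure _)
        hsub ?_ ha hb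
      rintro _ ⟨a, ha, rfl⟩ _ ⟨b, hb, rfl⟩ c hc
      obtain ⟨d, hd, habd⟩ := hD.nthProduct a ha b hb n
      rw [hc.unique (habd.extendDistribution (hD.fld_le ha) (hD.fld_le hb))]
      exact Submodule.le_topologicalClosure _ (Submodule.subset_span ⟨d, hd, rfl⟩)
  · refine Submodule.topologicalClosure_mono (Submodule.span_le.2 ?_)
    exact fun a ha => (Submodule.mem_sInf).2 fun S hS => hS.2.1 ha

theorem VertexData.IsVertexAlgebra.extendDistribution_mem {a : Distribution R V} (ha : a ∈ D.Fld) :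
    extendDistribution K a ∈ (D.extendScalars K).Fld := by
  rw [hD.extendScalars_fld_eq K]
  exact Submodule.le_topologicalClosure _ (Submodule.subset_span ⟨a, ha, rfl⟩)

/-- Every closed submodule of distributions that contains the extensions of the fields of `D`
contains the fields of the extension of scalars. -/
theorem VertexData.IsVertexAlgebra.extendScalars_fld_le
    {M : Submodule K (Distribution K (ExtScalars R K V))}
    (hM : IsClosed (M : Set (Distribution K (ExtScalars R K V))))
    (h : ∀ a ∈ D.Fld, extendDistribution K a ∈ M) : (D.extendScalars K).Fld ≤ M := by
  rw [hD.extendScalars_fld_eq K]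
  refine Submodule.topologicalClosure_minimal _ (Submodule.span_le.2 ?_) hM
  rintro _ ⟨a, ha, rfl⟩
  exact h a ha

theorem VertexData.IsVertexAlgebra.extendScalars_vacuum_axiom (a) (ha : a ∈ (D.extendScalars K).Fld)
    (n : ℤ) (hn : 0 ≤ n) : a.coeff n (D.extendScalars K).vacuum = 0 := by
  let M : Submodule K (Distribution K (ExtScalars R K V)) :=
    { carrier := {a | a.coeff n (D.extendScalars K).vacuum = 0}
      add_mem' := fun {a b} ha hb => by
        rw [Set.mem_ofPred_eq] at *
        rw [Distribution.coeff_add, NormedAddGroupHom.add_apply, ha, hb, add_zero]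
      zero_mem' := rfl
      smul_mem' := fun c a ha => by
        rw [Set.mem_ofPred_eq] at *
        rw [Distribution.coeff_smul, NormedAddGroupHom.smul_apply, ha, smul_zero] }
  have hM : IsClosed (M : Set (Distribution K (ExtScalars R K V))) :=
    isClosed_eq (continuous_coeff_apply _ _) continuous_const
  refine hD.extendScalars_fld_le hM (fun a ha => ?_) ha
  refine (extends_coeff a n 1 D.vacuum).trans ?_
  rw [hD.vacuum_axiom a ha n hn, map_zero]

theorem VertexData.IsVertexAlgebra.extendScalars_translation (a)
    (ha : a ∈ (D.extendScalars K).Fld) : TranslationCovariant (D.extendScalars K).T a := by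
  set T := (D.extendScalars K).T
  let M : Submodule K (Distribution K (ExtScalars R K V)) :=
    { carrier := {a | ∀ n v, T.1 (a.coeff n v) - a.coeff n (T.1 v) = (-n) • a.coeff (n - 1) v}
      add_mem' := fun {a b} ha hb n v => by
        simp only [Distribution.coeff_add, NormedAddGroupHom.add_apply, smul_add, map_add]
        rw [← ha, ← hb]
        abel
      zero_mem' := fun n v => by simp
      smul_mem' := fun c a ha n v => by
        simp only [Distribution.coeff_smul, NormedAddGroupHom.smul_apply]
        rw [smul_comm, ← ha, BEnd.map_smul, smul_sub] }
  have hM : IsClosed (M : Set (Distribution K (ExtScalars R K V))) := by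
    change IsClosed {a : Distribution K (ExtScalars R K V) |
      ∀ n v, T.1 (a.coeff n v) - a.coeff n (T.1 v) = (-n) • a.coeff (n - 1) v}
    simp only [Set.ofPred_forall]
    exact isClosed_iInter fun n => isClosed_iInter fun v => isClosed_eq
      ((T.1.continuous.comp (continuous_coeff_apply n v)).sub (continuous_coeff_apply _ _))
      ((continuous_coeff_apply _ _).const_smul (-n))
  have h := hD.extendScalars_fld_le hM (fun a ha n v => ?_) ha
  · intro n
    ext v
    exact h n v
  · exact DFunLike.congr_fun ((hD.translation a ha).extendDistribution (K := K) n) v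

theorem VertexData.IsVertexAlgebra.extendScalars_locality (a) (ha : a ∈ (D.extendScalars K).Fld)
    (b) (hb : b ∈ (D.extendScalars K).Fld) : MutuallyLocal a b := by
  rw [hD.extendScalars_fld_eq K] at ha hb
  refine mutuallyLocal_of_mem_closure_span ?_ ha hb
  rintro _ ⟨a, ha, rfl⟩ _ ⟨b, hb, rfl⟩
  exact (hD.locality a ha b hb).extendDistribution

theorem VertexData.IsVertexAlgebra.extendScalars_fld_le_fieldSpace :
    (D.extendScalars K).Fld ≤ fieldSpace K (ExtScalars R K V) :=
  hD.extendScalars_fld_le isClosed_fieldSpace fun _ ha =>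
    extendDistribution_mem_fieldSpace (hD.fld_le ha)

theorem VertexData.IsVertexAlgebra.extendScalars_nthProduct
    (a) (ha : a ∈ (D.extendScalars K).Fld) (b) (hb : b ∈ (D.extendScalars K).Fld) (n : ℤ) :
    ∃ c ∈ (D.extendScalars K).Fld, IsNthProduct a b n c := by
  have := hD.ultrametric
  obtain ⟨c, hc⟩ := exists_isNthProduct (hD.extendScalars_fld_le_fieldSpace ha)
    (hD.extendScalars_fld_le_fieldSpace hb) n
  refine ⟨c, ?_, hc⟩
  rw [hD.extendScalars_fld_eq K] at ha hb ⊢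
  refine mem_of_isNthProduct_of_mem_closure_span (Submodule.isClosed_topologicalClosure _)
    ?_ ?_ ha hb c hc
  · rintro _ ⟨a, ha, rfl⟩
    exact extendDistribution_mem_fieldSpace (hD.fld_le ha)
  · rintro _ ⟨a, ha, rfl⟩ _ ⟨b, hb, rfl⟩ c hc
    obtain ⟨d, hd, habd⟩ := hD.nthProduct a ha b hb n
    rw [hc.unique (habd.extendDistribution (hD.fld_le ha) (hD.fld_le hb))]
    exact Submodule.le_topologicalClosure _ (Submodule.subset_span ⟨d, hd, rfl⟩)

theorem VertexData.IsVertexAlgebra.dense_extendScalars [Nontrivial K]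
    (hgood : ∀ v : V, ∃ r : R, (∀ x : K, ‖x‖ ≤ ‖algebraMap R K r * x‖) ∧
      r • v ∈ LinearMap.range D.fs) :
    Dense {v : ExtScalars R K V | ∃ c : K, c ≠ 0 ∧
      c • v ∈ LinearMap.range (D.extendScalars K).fs} := by
  refine (UniformSpace.Completion.denseRange_coe (α := PreTensor R K V)).mono ?_
  rintro _ ⟨t, rfl⟩
  -- Not decreasing norms is stronger than being nonzero and, unlike the latter, is stable under
  -- products; a sum of two tensors needs the product of their scalars.
  suffices h : ∃ r : R, (∀ x : K, ‖x‖ ≤ ‖algebraMap R K r * x‖) ∧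
      algebraMap R K r • (t : ExtScalars R K V) ∈ LinearMap.range (D.extendScalars K).fs by
    obtain ⟨r, hr, ht⟩ := h
    refine ⟨algebraMap R K r, fun h0 => ?_, ht⟩
    have := hr 1
    rw [h0, zero_mul, norm_zero, norm_le_zero_iff] at this
    exact one_ne_zero this
  induction t using PreTensor.induction_on with
  | zero =>
    refine ⟨1, fun x => by simp, ?_⟩
    rw [UniformSpace.Completion.coe_zero, smul_zero]
    exact zero_mem _
  | mk x v =>
    obtain ⟨r, hr, a, ha⟩ := hgood v
    refine ⟨r, hr, x • ⟨_, hD.extendDistribution_mem a.2⟩, ?_⟩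
    rw [map_smul]
    change x • (extendDistribution K a.1).coeff (-1) (D.extendScalars K).vacuum =
      algebraMap R K r • tensorLeft R K x v
    rw [VertexData.coeff_extendDistribution_vacuum, smul_tensorLeft, mul_one, ha, tensorLeft_smul]
  | add s t hs ht =>
    obtain ⟨r, hr, hrs⟩ := hs
    obtain ⟨q, hq, hqt⟩ := ht
    refine ⟨r * q, fun x => ?_, ?_⟩
    · rw [map_mul, mul_assoc]
      exact (hq x).trans (hr _)
    · rw [UniformSpace.Completion.coe_add, smul_add, map_mul, mul_smul, mul_smul,
        smul_comm (algebraMap R K r) (algebraMap R K q) (s : ExtScalars R K V)]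
      exact add_mem (Submodule.smul_mem _ _ hrs) (Submodule.smul_mem _ _ hqt)

/-- An isometry from a complete space has closed image, and the image contains `x ⊗ fs a` as the
state of `x` times the extension of `a`. -/
theorem VertexData.IsVertexAlgebra.extendScalars_fs_surjective
    (hsurj : Function.Surjective D.fs) (hiso : Isometry (D.extendScalars K).fs) :
    Function.Surjective (D.extendScalars K).fs := by
  have := completeSpace_distribution (K := K) (V := ExtScalars R K V)
  have hcl : IsClosed ((D.extendScalars K).Fld : Set (Distribution K (ExtScalars R K V))) :=
    Submodule.isClosed_topologicalClosure _
  have : CompleteSpace (D.extendScalars K).Fld := hcl.completeSpace_coe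
  intro x
  change x ∈ Set.range (D.extendScalars K).fs
  induction x using ExtScalars.induction_on with
  | closed => exact hiso.isClosedEmbedding.isClosed_range
  | tensor x v =>
    obtain ⟨a, rfl⟩ := hsurj v
    refine ⟨x • ⟨_, hD.extendDistribution_mem a.2⟩, ?_⟩
    rw [map_smul]
    refine (congrArg (x • ·) (VertexData.coeff_extendDistribution_vacuum a)).trans ?_
    change x • tensorLeft R K 1 (D.fs a) = _
    rw [smul_tensorLeft, mul_one]
  | add x y hx hy =>
    obtain ⟨a, rfl⟩ := hx
    obtain ⟨b, rfl⟩ := hy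
    exact ⟨a + b, map_add _ a b⟩

variable [CompleteSpace K] [IsUltrametricDist K] {ι : Type*} (B : Module.Basis ι R V)
  (hB : ∀ i, ‖B i‖ ≤ 1) (hBK : ∀ v i, ‖algebraMap R K (B.repr v i)‖ ≤ ‖v‖)
  (hV : ∀ v : V, v ≠ 0 → ‖v‖ = 1) (hK : ‖(1 : K)‖ ≤ 1)
  (hinj : Function.Injective D.fs)
  (hgood : ∀ v : V, ∃ r : R, (∀ x : K, ‖x‖ ≤ ‖algebraMap R K r * x‖) ∧
      r • v ∈ LinearMap.range D.fs)

include B hB hBK hV hK hinj hgood in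
theorem VertexData.IsVertexAlgebra.norm_extendScalars_fs (a : (D.extendScalars K).Fld) :
    ‖(D.extendScalars K).fs a‖ = ‖a‖ := by
  refine le_antisymm ?_ ?_
  · refine (a.1.norm_coeff_apply_le (-1) (D.extendScalars K).vacuum).trans ?_
    refine mul_le_of_le_one_right (norm_nonneg _) ((norm_tensorLeft_le 1 D.vacuum).trans ?_)
    refine mul_le_one₀ hK (norm_nonneg _) ?_
    by_cases h : D.vacuum = 0
    · simp [h]
    · exact (hV _ h).le
  have hcl : IsClosed {a : Distribution K (ExtScalars R K V) |
      ‖a‖ ≤ ‖a.coeff (-1) (D.extendScalars K).vacuum‖} :=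
    isClosed_le continuous_norm (continuous_coeff_apply _ _).norm
  -- The lower bound is a closed condition, so only the algebraic span remains.
  have ha : a.1 ∈ closure _ := (hD.extendScalars_fld_eq K).le a.2
  refine closure_minimal (fun a ha => ?_) hcl ha
  rw [SetLike.mem_coe] at ha
  obtain ⟨s, hs⟩ := VertexData.smul_eq_sum_coord_smul B hBK hinj ha
  obtain ⟨r, hr, hrs⟩ := VertexData.exists_smul_mem_range_of_finset B hgood s
  have hc : ∀ i, ∃ c : D.Fld, i ∈ s → D.fs c = r • B i := fun i => by
    by_cases hi : i ∈ s
    · obtain ⟨c, hc⟩ := hrs i hi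
      exact ⟨c, fun _ => hc⟩
    · exact ⟨0, fun h => absurd h hi⟩
  choose c hc using hc
  have h1 : ‖a‖ ≤ ‖algebraMap R K r • a‖ := Distribution.norm_le (norm_nonneg _) fun n v =>
    (norm_le_norm_smul B hBK hB hr _).trans
      ((algebraMap R K r • a).norm_coeff_apply_le n v)
  refine h1.trans ?_
  rw [hs s subset_rfl r c hc]
  refine IsUltrametricDist.norm_sum_le_of_forall_le_of_nonneg (norm_nonneg _) fun i _ => ?_
  -- Each summand is a coordinate of the state of `a` times an extended field, whose norm is at most
  -- 1.
  refine (norm_smul_le _ _).trans ?_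
  refine (mul_le_mul (norm_coord_le B hBK i _) ((norm_extendDistribution_le _).trans
    (Distribution.norm_le_one hV _)) (norm_nonneg _) (norm_nonneg _)).trans_eq (mul_one _)

include B hB hBK hgood in
theorem VertexData.IsVertexAlgebra.extendScalars [Nontrivial K] [IsAddTorsionFree K] :
    (D.extendScalars K).IsVertexAlgebra where
  ring_complete := inferInstance
  ring_ultrametric := inferInstance
  ring_torsionFree := inferInstance
  complete := inferInstance
  ultrametric := inferInstance
  addTorsionFree := isAddTorsionFree_extScalars B hBK hB
  torsionFree := isTorsionFree_extScalars B hBK hB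
  T_vacuum := (extends_extendEnd D.T 1 D.vacuum).trans (by rw [hD.T_vacuum, map_zero])
  fld_le := hD.extendScalars_fld_le_fieldSpace
  fld_closed := Submodule.isClosed_topologicalClosure _
  id_mem := by
    rw [← extendDistribution_idField]
    exact hD.extendDistribution_mem hD.id_mem
  vacuum_axiom := hD.extendScalars_vacuum_axiom
  translation := hD.extendScalars_translation
  locality := hD.extendScalars_locality
  nthProduct := hD.extendScalars_nthProduct
  dense := hD.dense_extendScalars hgood

include B hB hBK hV hK hinj hgood in
theorem VertexData.IsVertexAlgebra.extendScalars_isometry [Nontrivial K] [IsAddTorsionFree K] :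
    (D.extendScalars K).IsVertexAlgebra ∧ (D.extendScalars K).IsAdmissible ∧
      Isometry (D.extendScalars K).fs :=
  have h := hD.norm_extendScalars_fs B hB hBK hV hK hinj hgood
  ⟨hD.extendScalars B hB hBK hgood, isAdmissibleHom_of_norm_eq _ h,
    AddMonoidHomClass.isometry_of_norm _ h⟩

end ExtendScalars

end NAVertex

end

/-! ### The main theorem -/

theorem mainTheorem9 {R K V : Type*} [NormedCommRing R] [NormedCommRing K]
    [CompleteSpace K] [IsUltrametricDist K] [IsAddTorsionFree K]
    [Algebra R K] [NormedAddCommGroup V] [Module R V] [IsBoundedSMul R V] [Module.Free R V]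
    (hR : ∀ r : R, r ≠ 0 → ‖r‖ = 1) (hV : ∀ v : V, v ≠ 0 → ‖v‖ = 1)
    (hinj : Function.Injective (algebraMap R K))
    (hnorm : ∀ r : R, ‖algebraMap R K r‖ ≤ ‖r‖)
    (D : NAVertex.VertexData R V) (hD : D.IsVertexAlgebra) :
    (Function.Bijective D.fs →
      (D.extendScalars K).IsVertexAlgebra ∧ (D.extendScalars K).IsAdmissible ∧
        Isometry (D.extendScalars K).fs ∧ Function.Bijective (D.extendScalars K).fs) ∧
    ((∀ r : R, r ≠ 0 → ‖algebraMap R K r‖ = 1) →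
      (∀ (r : R) (x : K), ‖algebraMap R K r * x‖ = ‖algebraMap R K r‖ * ‖x‖) →
      (D.extendScalars K).IsVertexAlgebra ∧ (D.extendScalars K).IsAdmissible ∧
        Isometry (D.extendScalars K).fs ∧ Function.Injective (D.extendScalars K).fs) := by
  have : Nontrivial R := by
    -- Even for the zero vector, the density axiom supplies a nonzero scalar.
    obtain ⟨r, hr, -⟩ := hD.exists_smul_mem_range hV 0
    exact ⟨r, 0, hr⟩
  have : Nontrivial K := hinj.nontrivial
  have hR' : ∀ r : R, ‖r‖ ≤ 1 := fun r => by
    by_cases h : r = 0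
    · simp [h]
    · exact (hR r h).le
  have hV' : ∀ v : V, ‖v‖ ≤ 1 := fun v => by
    by_cases h : v = 0
    · simp [h]
    · exact (hV v h).le
  have hK : ‖(1 : K)‖ ≤ 1 := by
    rw [← map_one (algebraMap R K)]
    exact (hnorm 1).trans (hR' 1)
  let B := Module.Free.chooseBasis R V
  have hBK : ∀ v i, ‖algebraMap R K (B.repr v i)‖ ≤ ‖v‖ := fun v i => by
    by_cases h : v = 0
    · simp [h]
    · rw [hV v h]
      exact (hnorm _).trans (hR' _)
  refine ⟨fun hbij => ?_, fun hone hmul => ?_⟩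
  · obtain ⟨h1, h2, h3⟩ := hD.extendScalars_isometry B (fun i => hV' _) hBK hV hK hbij.1
      fun v => ⟨1, fun x => by simp, LinearMap.mem_range.2 (hbij.2 _)⟩
    exact ⟨h1, h2, h3, h3.injective, hD.extendScalars_fs_surjective hbij.2 h3⟩
  -- Nonzero `r`, `s` have norm 1 in `K`, so by multiplicativity their product has norm 1 as well.
  · have : NoZeroDivisors R := ⟨fun {r s} hrs => by
      by_contra! h
      have h1 := hmul r (algebraMap R K s)
      rw [← map_mul, hrs, map_zero, norm_zero, hone r h.1, hone s h.2] at h1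
      norm_num at h1⟩
    have : IsDomain R := NoZeroDivisors.to_isDomain R
    obtain ⟨h1, h2, h3⟩ := hD.extendScalars_isometry B (fun i => hV' _) hBK hV hK
      (hD.fs_injective hV) fun v => by
        obtain ⟨r, hr, hrv⟩ := hD.exists_smul_mem_range hV v
        exact ⟨r, fun x => by rw [hmul, hone r hr, one_mul], hrv⟩
    exact ⟨h1, h2, h3, h3.injective⟩
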